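/- **Setting.** Let $S$ (schools), $I$ (students) and $T$ (types) be finite sets, and let school $s$ have capacity $q_s\ge 1$. A matching $\mu$ assigns to each $i\in I$ some $\mu(i)\in S\cup\{\emptyset\}$ and to each $s\in S$ the set $\mu(s)=\{i:\mu(i)=s\}$, with $|\mu(s)|\le q_s$. Each student $i$ has a linear order $R_i$ on $S\cup\{\emptyset\}$ with strict part $P_i$. For each $s$ there is a type function $\tau^s:I\cup\{\emptyset\}\to T$ with $\tau^s(\emptyset)\ne\tau^s(i)$ for all $i\in I$; write $I^t=\{i\in I:\tau^s(i)=t\}$. Let $\mathcal J_s=\{J\subseteq I: |J|\le q_s-1\}$. For each $J\in\mathcal J_s$ let $\succsim_s^J$ be a weak order (complete and transitive) on $(I\setminus J)\cup\{\emptyset\}$, with asymmetric part $\succ_s^J$ and symmetric part $\sim_s^J$. The following conditions are required whenever every set that occurs as an upper index lies in $\mathcal J_s$ and the elements compared lie in the corresponding domain. - **PD:** if $i,j\in (I\cup\{\emptyset\})\setminus (J\cup J')$, $|J\cap I^{\tau^s(i)}|\ge|J'\cap I^{\tau^s(i)}|$ and $|J\cap I^{\tau^s(j)}|\le|J'\cap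 I^{\tau^s(j)}|$, then $i\succ_s^J j$ implies $i\succ_s^{J'}j$, and $i\succsim_s^J j$ implies $i\succsim_s^{J'}j$. - **WO:** if $i,j\in (I\cup\{\emptyset\})\setminus (J\cup J')$ and $\tau^s(i)=\tau^s(j)$, then $i\succ_s^J j$ implies $i\succ_s^{J'}j$, and $i\succsim_s^J j$ implies $i\succsim_s^{J'}j$. - **DC:** if $i,j\in I\setminus J$ are distinct, $k\in (I\cup\{\emptyset\})\setminus (J\cup\{i,j\})$, $\tau^s(i)=\tau^s(j)$ and $i\succsim_s^J j$, then $j\succ_s^{J\cup\{i\}}k$ implies $i\succ_s^{J\cup\{j\}}k$; $j\sim_s^{J\cup\{i\}}k$ implies $i\succsim_s^{J\cup\{j\}}k$; and $k\succ_s^{J\cup\{j\}}i$ implies $k\succ_s^{J\cup\{i\}}j$. **Stability.** A matching $\mu$ is *stable* (for $P$) if it is (a) non-wasteful: $sP_i\mu(i)$ implies $\emptyset\succ_s^{\mu(s)}i$ or $|\mu(s)|=q_s$; (b) individually rational: $\mu(i)R_i\emptyset$ for all $i$, and $i\succsim_s^{\mu(s)\setminus\{i\}}\emptyset$ for all $s$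 and $i\in\mu(s)$; (c) fair: there are no $i,j,s$ with $\mu(j)=s$, $sP_i\mu(i)$ and $i\succ_s^{\mu(s)\setminus\{j\}}j$. A mechanism (a map $\phi$ from preference profiles to matchings) is *stable* if $\phi(P)$ is stable for every $P$. It is *group strategy-proof* if for no $P$ there are a nonempty $J\subseteq I$ and reports $P'_J$ with $\phi(P'_J,P_{-J})(j)\,P_j\,\phi(P)(j)$ for all $j\in J$. **Choice function.** For each $s$, number the types $0,1,\dots,|T|-1$ with $\tau^s(\emptyset)$ numbered $0$, and number the students so that students whose type has a smaller number come first and so that, for $i,j$ of the same type with $i$ numbered before $j$, $i\succsim_s^J j$ for every $J\in\mathcal J_s$ with $i,j\notin J$. A student $i\in K$ has the *lowest priority within* $K$ if no $j\in K\setminus\{i\}$ satisfies $i\succ_s^{K\setminus\{i,j\}}j$. To define $C_s^{\succsim}(J)$, start from $A=\emptyset$ and let the members $a$ of $J$ apply in increasing order. If $|A|<q_s$, replace $A$ by $A\cup\{a\}$ when $a\succsim_s^A\emptyset$ and keep $A$ otherwise. If $|A|=q_s$, replace $A$ by $(A\cup\{a\})\setminus\{r\}$, where $r$ is the most recent applicant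 (largest number) among the students with the lowest priority within $A\cup\{a\}$. The final $A$ is $C_s^{\succsim}(J)$. **Mechanism.** $\bar\phi(P)$ is the result of student-proposing deferred acceptance with $C^{\succsim}=(C^{\succsim}_s)_{s\in S}$. Initially nobody is held. In each round one student $i$ who is not tentatively held, and who has not been rejected by all acceptable schools, applies to her most preferred school $s$ among those that have not rejected her; $s$, holding $J_s$, then holds $C_s^{\succsim}(J_s\cup\{i\})$ and rejects the other members of $J_s\cup\{i\}$. The algorithm ends when no such student exists. **Theorem 1.** Suppose that every school's profile $(\succsim_s^J)_{J\in\mathcal J_s}$ satisfies PD, WO and DC. Then numberings as above exist, and for every choice of them $\bar\phi$ is well defined (deferred acceptance always terminates, and its result is a matching that does not depend on which student is selected in each round), and $\bar\phi$ is stable and group strategy-proof. -/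

import Mathlib

namespace SchoolChoice

/-! ### Matchings, preferences -/

/-- A matching of the students `I` to the schools `S` with capacities `q`; `none` means that a
student is unassigned. (That `school i = none` iff `i` belongs to no `students s` follows from
`mem_iff`.) -/
structure Matching (S I : Type*) (q : S → ℕ) where
  school : I → Option S
  students : S → Finset I
  mem_iff : ∀ i s, school i = some s ↔ i ∈ students s
  card_le : ∀ s, (students s).card ≤ q s

/-- A linear order over `S ∪ {∅}` (`none` is the outside option); `R a b` is "at least as good". -/
structure Pref (S : Type*) where
  R : Option S → Option S → Prop
  total : ∀ a b, R a b ∨ R b a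
  trans : ∀ a b c, R a b → R b c → R a c
  antisymm : ∀ a b, R a b → R b a → a = b

/-- Strict preference. -/
def Pref.P {S : Type*} (p : Pref S) (a b : Option S) : Prop := p.R a b ∧ a ≠ b

/-! ### Assignment-dependent priorities of one school

`pri J x y` reads: `x` has weakly higher priority than `y` when the students in `J` hold seats;
`none` is the empty option. It matters only for `J` with a free seat (`J.card < q`) and for `x`, `y`
in `(I \ J) ∪ {∅}`. -/

/-- The priority relations of one school, indexed by the set of assigned students. -/
abbrev PriorityProfile (I : Type*) := Finset I → Option I → Option I → Prop

/-- `x ∈ (I \ J) ∪ {∅}`. -/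
def IsCandidate {I : Type*} (J : Finset I) (x : Option I) : Prop := ∀ i : I, x = some i → i ∉ J

/-- The asymmetric part. -/
def StrictPri {I : Type*} (pri : PriorityProfile I) (J : Finset I) (x y : Option I) : Prop :=
  pri J x y ∧ ¬ pri J y x

/-- The symmetric part. -/
def TiedPri {I : Type*} (pri : PriorityProfile I) (J : Finset I) (x y : Option I) : Prop :=
  pri J x y ∧ pri J y x

/-- For every `J` with a free seat, `pri J` is a weak order on `(I \ J) ∪ {∅}`. -/
def IsWeakOrderProfile {I : Type*} (q : ℕ) (pri : PriorityProfile I) : Prop :=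
  ∀ J : Finset I, J.card < q →
    (∀ x y, IsCandidate J x → IsCandidate J y → pri J x y ∨ pri J y x) ∧
    (∀ x y z, IsCandidate J x → IsCandidate J y → IsCandidate J z →
      pri J x y → pri J y z → pri J x z)

open Classical in
/-- The number of students of type `t` in `J`. -/
noncomputable def typeCount {I T : Type*} (τ : Option I → T) (J : Finset I) (t : T) : ℕ :=
  (J.filter (fun j => τ (some j) = t)).card

/-- Preference for diversity. -/
def PD {I T : Type*} (q : ℕ) (τ : Option I → T) (pri : PriorityProfile I) : Prop :=
  ∀ (J J' : Finset I) (x y : Option I), J.card < q → J'.card < q →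
    IsCandidate J x → IsCandidate J y → IsCandidate J' x → IsCandidate J' y →
    typeCount τ J' (τ x) ≤ typeCount τ J (τ x) →
    typeCount τ J (τ y) ≤ typeCount τ J' (τ y) →
    (StrictPri pri J x y → StrictPri pri J' x y) ∧ (pri J x y → pri J' x y)

/-- Within-type ordering. -/
def WO {I T : Type*} (q : ℕ) (τ : Option I → T) (pri : PriorityProfile I) : Prop :=
  ∀ (J J' : Finset I) (x y : Option I), J.card < q → J'.card < q →
    IsCandidate J x → IsCandidate J y → IsCandidate J' x → IsCandidate J' y →
    τ x = τ y →
    (StrictPri pri J x y → StrictPri pri J' x y) ∧ (pri J x y → pri J' x y)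

/-- Distributional consistency. Two distinct elements of `I ∪ {∅}` with the same type are both
students, so `i` and `j` are students; `k` may be `∅`. -/
def DC {I T : Type*} [DecidableEq I] (q : ℕ) (τ : Option I → T) (pri : PriorityProfile I) : Prop :=
  ∀ (J : Finset I) (i j : I) (k : Option I), (insert i J).card < q → (insert j J).card < q →
    i ≠ j → i ∉ J → j ∉ J → IsCandidate J k → k ≠ some i → k ≠ some j →
    τ (some i) = τ (some j) → pri J (some i) (some j) →
    (StrictPri pri (insert i J) (some j) k → StrictPri pri (insert j J) (some i) k) ∧
    (TiedPri pri (insert i J) (some j) k → pri (insert j J) (some i) k) ∧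
    (StrictPri pri (insert j J) k (some i) → StrictPri pri (insert i J) k (some j))

/-! ### Properties of matchings and mechanisms -/

def NonWasteful {S I : Type*} {q : S → ℕ} (pri : S → PriorityProfile I) (P : I → Pref S)
    (μ : Matching S I q) : Prop :=
  ∀ (i : I) (s : S), (P i).P (some s) (μ.school i) →
    StrictPri (pri s) (μ.students s) none (some i) ∨ (μ.students s).card = q s

def IndividuallyRational {S I : Type*} [DecidableEq I] {q : S → ℕ} (pri : S → PriorityProfile I)
    (P : I → Pref S) (μ : Matching S I q) : Prop :=
  (∀ i, (P i).R (μ.school i) none) ∧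
  ∀ s, ∀ i ∈ μ.students s, pri s (μ.students s \ {i}) (some i) none

/-- `i` has justified envy toward `j` at `μ`. -/
def JustifiedEnvy {S I : Type*} [DecidableEq I] {q : S → ℕ} (pri : S → PriorityProfile I)
    (P : I → Pref S) (μ : Matching S I q) (i j : I) : Prop :=
  ∃ s, μ.school j = some s ∧ (P i).P (some s) (μ.school i) ∧
    StrictPri (pri s) (μ.students s \ {j}) (some i) (some j)

def Fair {S I : Type*} [DecidableEq I] {q : S → ℕ} (pri : S → PriorityProfile I)
    (P : I → Pref S) (μ : Matching S I q) : Prop :=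
  ∀ i j, ¬ JustifiedEnvy pri P μ i j

def Stable {S I : Type*} [DecidableEq I] {q : S → ℕ} (pri : S → PriorityProfile I)
    (P : I → Pref S) (μ : Matching S I q) : Prop :=
  NonWasteful pri P μ ∧ IndividuallyRational pri P μ ∧ Fair pri P μ

/-- A mechanism maps preference profiles to matchings. -/
abbrev Mechanism (S I : Type*) (q : S → ℕ) := (I → Pref S) → Matching S I q

def StableMechanism {S I : Type*} [DecidableEq I] {q : S → ℕ} (pri : S → PriorityProfile I)
    (φ : Mechanism S I q) : Prop :=
  ∀ P, Stable pri P (φ P)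

/-- No nonempty group `J` can misreport so that all its members are strictly better off. -/
def GroupStrategyProof {S I : Type*} {q : S → ℕ} (φ : Mechanism S I q) : Prop :=
  ∀ P : I → Pref S, ¬ ∃ (J : Finset I) (P' : I → Pref S), J.Nonempty ∧
    (∀ i, i ∉ J → P' i = P i) ∧ ∀ j ∈ J, (P j).P ((φ P').school j) ((φ P).school j)

/-! ### The choice function built from a priority profile -/

/-- A numbering of the types and of the students (used by one school). -/
structure Numbering (I T : Type*) [Fintype I] [Fintype T] where
  typeNum : T ≃ Fin (Fintype.card T)
  num : I ≃ Fin (Fintype.card I)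

/-- The type of `∅` is number `0`; students of a type with a smaller number come first; within a
type, a later student never has strictly higher priority than an earlier one. -/
structure Numbering.Compatible {I T : Type*} [Fintype I] [Fintype T] (ν : Numbering I T)
    (q : ℕ) (τ : Option I → T) (pri : PriorityProfile I) : Prop where
  type_none : (ν.typeNum (τ none) : ℕ) = 0
  type_lt : ∀ i j : I, ν.typeNum (τ (some i)) < ν.typeNum (τ (some j)) → ν.num i < ν.num j
  within_type : ∀ i j : I, τ (some i) = τ (some j) → ν.num i < ν.num j →
    ∀ J : Finset I, J.card < q → i ∉ J → j ∉ J → pri J (some i) (some j)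

/-- `i` has the lowest priority within `K`: no `j ∈ K` has a lower priority than `i` with
`K \ {i, j}`. -/
def HasLowestPriority {I : Type*} [DecidableEq I] (pri : PriorityProfile I) (K : Finset I)
    (i : I) : Prop :=
  i ∈ K ∧ ∀ j ∈ K, ¬ StrictPri pri (K \ {i, j}) (some i) (some j)

/-- Among the members of `K` with the lowest priority within `K`, `i` is the one with the largest
number, that is, the most recent applicant. -/
def IsRejected {I : Type*} [DecidableEq I] {n : ℕ} (pri : PriorityProfile I) (num : I ≃ Fin n)
    (K : Finset I) (i : I) : Prop :=
  HasLowestPriority pri K i ∧ ∀ j, HasLowestPriority pri K j → num j ≤ num i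

open Classical in
/-- One step of the sequential acceptance: `A` is the set accepted so far and `a` applies. -/
noncomputable def choiceStep {I : Type*} [DecidableEq I] {n : ℕ} (q : ℕ) (pri : PriorityProfile I)
    (num : I ≃ Fin n) (A : Finset I) (a : I) : Finset I :=
  if A.card < q then
    if pri A (some a) none then insert a A else A
  else
    (insert a A).filter (fun i => ¬ IsRejected pri num (insert a A) i)

/-- The members of `J` listed by increasing number. -/
def applicants {I : Type*} [DecidableEq I] {n : ℕ} (num : I ≃ Fin n) (J : Finset I) : List I :=
  ((List.finRange n).map num.symm).filter (fun i => i ∈ J)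

/-- The choice function of a school: the members of `J` apply one by one. -/
noncomputable def choiceFn {I : Type*} [DecidableEq I] {n : ℕ} (q : ℕ) (pri : PriorityProfile I)
    (num : I ≃ Fin n) (J : Finset I) : Finset I :=
  (applicants num J).foldl (choiceStep q pri num) ∅

/-! ### Student-proposing deferred acceptance with choice functions -/

/-- The tentatively matched students of each school, and the schools that have rejected each
student so far. -/
structure SPDAState (S I : Type*) where
  held : S → Finset I
  rejectedBy : I → Finset S

def SPDAState.init (S I : Type*) : SPDAState S I := ⟨fun _ => ∅, fun _ => ∅⟩

/-- Student `i` may apply to `s` now: `i` is not tentatively matched, `s` has not rejected `i`,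
`s` is the best school for `i` among those that have not rejected `i`, and `s` is acceptable. -/
def CanApply {S I : Type*} (P : I → Pref S) (σ : SPDAState S I) (i : I) (s : S) : Prop :=
  (∀ s', i ∉ σ.held s') ∧ s ∉ σ.rejectedBy i ∧
  (∀ s', s' ∉ σ.rejectedBy i → (P i).R (some s) (some s')) ∧ (P i).R (some s) none

/-- The state after `i` applies to `s`: `s` keeps its choice from the students it holds and `i`,
and rejects the others. -/
def applyTo {S I : Type*} [DecidableEq S] [DecidableEq I] (C : S → Finset I → Finset I)
    (σ : SPDAState S I) (i : I) (s : S) : SPDAState S I where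
  held := Function.update σ.held s (C s (insert i (σ.held s)))
  rejectedBy := fun j =>
    if j ∈ insert i (σ.held s) \ C s (insert i (σ.held s)) then insert s (σ.rejectedBy j)
    else σ.rejectedBy j

/-- One round, for any student that can be picked. -/
def SPDARound {S I : Type*} [DecidableEq S] [DecidableEq I] (C : S → Finset I → Finset I)
    (P : I → Pref S) (σ σ' : SPDAState S I) : Prop :=
  ∃ i s, CanApply P σ i s ∧ σ' = applyTo C σ i s

/-- There is no infinite run of the algorithm. -/
def SPDATerminates {S I : Type*} [DecidableEq S] [DecidableEq I] (C : S → Finset I → Finset I)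
    (P : I → Pref S) : Prop :=
  ¬ ∃ run : ℕ → SPDAState S I, run 0 = SPDAState.init S I ∧
    ∀ d, SPDARound C P (run d) (run (d + 1))

/-- `μ` is the result of a complete run of the algorithm. -/
def IsSPDAOutcome {S I : Type*} [DecidableEq S] [DecidableEq I] {q : S → ℕ}
    (C : S → Finset I → Finset I) (P : I → Pref S) (μ : Matching S I q) : Prop :=
  ∃ σ : SPDAState S I, Relation.ReflTransGen (SPDARound C P) (SPDAState.init S I) σ ∧
    (¬ ∃ σ', SPDARound C P σ σ') ∧ ∀ s, μ.students s = σ.held s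

end SchoolChoice

/-! There are two halves. The first treats one school. Ties are broken by the numbering (`Ahead`),
so that within a type priority is just the number. For a set `K` of at most `q + 1` students,
comparing `i` and `j` with `K \ {i, j}` assigned is then a transitive relation (`aheadIn_trans`),
although each pair uses its own assigned set. Hence each full-school step rejects exactly one
student. By induction over the applicants, the final choice satisfies the conditions `IsChoice`: it
is an initial segment of each type, acceptable, non-wasteful and fair. These conditions suffice for
substitutability (`IsChoice.mem_of_mem`) and the law of aggregate demand (`IsChoice.card_mono`):
within a type choices are nested, so PD can compare two choices through their type counts.

The second half uses only those two properties. Rejections persist as applications accumulate, so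
there is a least closed family of applications, and every complete run of deferred acceptance
produces exactly it, whatever the order of proposals. Stability is then read off from `IsChoice`.

For group strategy-proofness, let a coalition obtain better schools by misreporting. Under the true
demands these schools reject its members. Moving a rejecting school to the top of a student's
ranking changes no application (`applications_lift`); the proof counts matched students with the law
of aggregate demand. Doing this for the whole coalition leaves the true outcome intact, yet the
misreported outcome shows that the same schools must accept the members (`not_profitable`), a
contradiction. -/

namespace SchoolChoice

/-! ### Counting the students of a type -/

theorem typeCount_le {I T : Type*} {τ : Option I → T} {A B : Finset I} {t : T}
    (h : ∀ x ∈ A, τ (some x) = t → x ∈ B) : typeCount τ A t ≤ typeCount τ B t := by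
  classical
  unfold typeCount
  refine Finset.card_le_card fun x hx => ?_
  simp only [Finset.mem_filter] at hx ⊢
  exact ⟨h x hx.1 hx.2, hx.2⟩

theorem typeCount_erase_add_one {I T : Type*} [DecidableEq I] {τ : Option I → T} {A : Finset I}
    {i : I} (hi : i ∈ A) :
    typeCount τ (A.erase i) (τ (some i)) + 1 = typeCount τ A (τ (some i)) := by
  classical
  unfold typeCount
  rw [Finset.filter_erase]
  exact Finset.card_erase_add_one (by simp [hi])

theorem typeCount_none {I T : Type*} {τ : Option I → T} (hτ : ∀ i, τ none ≠ τ (some i))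
    (A : Finset I) : typeCount τ A (τ none) = 0 := by
  classical
  unfold typeCount
  rw [Finset.card_eq_zero, Finset.filter_eq_empty_iff]
  exact fun x _ h => hτ x h.symm

theorem card_eq_sum_typeCount {I T : Type*} [Fintype T] (τ : Option I → T) (A : Finset I) :
    A.card = ∑ t, typeCount τ A t := by
  classical
  unfold typeCount
  rw [Finset.card_eq_sum_card_fiberwise (f := fun x => τ (some x)) (t := Finset.univ)
    (by simp)]

/-- If `A` has more students of type `t` than `B`, one of them is outside `B`, and `A` without
this student still has at least as many students of type `t` as `B`. -/
theorem exists_mem_of_typeCount_lt {I T : Type*} [DecidableEq I] {τ : Option I → T}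
    {A B : Finset I} {t : T} (h : typeCount τ B t < typeCount τ A t) :
    ∃ j ∈ A, j ∉ B ∧ typeCount τ B (τ (some j)) ≤ typeCount τ (A.erase j) (τ (some j)) := by
  by_contra! hc
  refine absurd (typeCount_le (τ := τ) (t := t) (A := A) (B := B) fun x hx hxt => ?_) (by omega)
  by_contra hxB
  have h1 := hc x hx hxB
  have h2 := typeCount_erase_add_one (τ := τ) hx
  rw [hxt] at h1 h2
  omega

theorem isCandidate_some {I : Type*} {J : Finset I} {i : I} (h : i ∉ J) :
    IsCandidate J (some i) := by
  rintro _ ⟨⟩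
  exact h

theorem isCandidate_none {I : Type*} {J : Finset I} : IsCandidate J none := by
  rintro _ ⟨⟩

/-- The bound `q + 1` is a full school plus one applicant; without the compared pair a seat is free,
so the axioms apply. -/
theorem card_sdiff_pair_lt {I : Type*} [DecidableEq I] {q : ℕ} {K : Finset I} {i j : I}
    (hK : K.card ≤ q + 1) (hi : i ∈ K) (hj : j ∈ K)
    (hij : i ≠ j) : (K \ {i, j}).card < q := by
  have h1 : ({i, j} : Finset I) ⊆ K := by simp [Finset.insert_subset_iff, hi, hj]
  have h2 := Finset.card_le_card h1
  rw [Finset.card_sdiff_of_subset h1]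
  rw [Finset.card_pair hij] at *
  omega

/-! ### A school with compatible numbering -/

/-- A school whose priority profile satisfies the three axioms, with a compatible numbering. -/
structure NumberedSchool {I T : Type*} [Fintype I] [DecidableEq I] [Fintype T] (q : ℕ)
    (τ : Option I → T) (pri : PriorityProfile I) (ν : Numbering I T) : Prop where
  one_le : 1 ≤ q
  none_ne : ∀ i, τ none ≠ τ (some i)
  weak : IsWeakOrderProfile q pri
  pd : PD q τ pri
  wo : WO q τ pri
  dc : DC q τ pri
  compat : ν.Compatible q τ pri

/-- `i` has higher priority than `j` when `B` is assigned, ties being broken by the numbering. -/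
def Ahead {I : Type*} {n : ℕ} (pri : PriorityProfile I) (num : I ≃ Fin n) (B : Finset I)
    (i j : I) : Prop :=
  pri B (some i) (some j) ∧ (pri B (some j) (some i) → num i < num j)

theorem Ahead.asymm {I : Type*} {n : ℕ} {pri : PriorityProfile I} {num : I ≃ Fin n}
    {B : Finset I} {i j : I} (h : Ahead pri num B i j) : ¬ Ahead pri num B j i :=
  fun h' => lt_asymm (h.2 h'.1) (h'.2 h.1)

/-! ### Tie-broken comparisons in one school. -/

section Priorities

variable {I T : Type*} [Fintype I] [DecidableEq I] [Fintype T] {q : ℕ}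
  {τ : Option I → T} {pri : PriorityProfile I} {ν : Numbering I T} {B B' J K : Finset I} {i j k : I}

namespace NumberedSchool

/-- Types occupy consecutive blocks of numbers, so a tie-break between different types depends on
the types alone. This makes tie-breaking compatible with swapping students of one type. -/
theorem num_lt_of_type (H : NumberedSchool q τ pri ν) {i' j' : I} (hi : τ (some i) = τ (some i'))
    (hj : τ (some j) = τ (some j')) (hij : τ (some i) ≠ τ (some j)) (h : ν.num i < ν.num j) :
    ν.num i' < ν.num j' := by
  rcases lt_trichotomy (ν.typeNum (τ (some i))) (ν.typeNum (τ (some j))) with hl | hl | hl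
  · rw [hi, hj] at hl
    exact H.compat.type_lt _ _ hl
  · exact absurd (ν.typeNum.injective hl) hij
  · exact absurd (H.compat.type_lt _ _ hl) h.not_gt

theorem total (H : NumberedSchool q τ pri ν) (hB : B.card < q) (hi : i ∉ B) (hj : j ∉ B) :
    pri B (some i) (some j) ∨ pri B (some j) (some i) :=
  (H.weak B hB).1 _ _ (isCandidate_some hi) (isCandidate_some hj)

theorem trans (H : NumberedSchool q τ pri ν) (hB : B.card < q) {x y z : Option I}
    (hx : IsCandidate B x) (hy : IsCandidate B y) (hz : IsCandidate B z)
    (hxy : pri B x y) (hyz : pri B y z) : pri B x z :=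
  (H.weak B hB).2 _ _ _ hx hy hz hxy hyz

theorem ahead_of_num_lt (H : NumberedSchool q τ pri ν) (hB : B.card < q) (hi : i ∉ B)
    (hj : j ∉ B) (ht : τ (some i) = τ (some j)) (h : ν.num i < ν.num j) :
    Ahead pri ν.num B i j :=
  ⟨H.compat.within_type i j ht h B hB hi hj, fun _ => h⟩

theorem num_lt_of_ahead (H : NumberedSchool q τ pri ν) (hB : B.card < q) (hi : i ∉ B)
    (hj : j ∉ B) (ht : τ (some i) = τ (some j)) (h : Ahead pri ν.num B i j) :
    ν.num i < ν.num j := by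
  rcases lt_trichotomy (ν.num i) (ν.num j) with hl | hl | hl
  · exact hl
  · obtain rfl := ν.num.injective hl
    exact h.2 h.1
  · exact absurd h (H.ahead_of_num_lt hB hj hi ht.symm hl).asymm

theorem ahead_total (H : NumberedSchool q τ pri ν) (hB : B.card < q) (hi : i ∉ B)
    (hj : j ∉ B) (hij : i ≠ j) : Ahead pri ν.num B i j ∨ Ahead pri ν.num B j i := by
  have hn : ν.num i ≠ ν.num j := fun h => hij (ν.num.injective h)
  have ht := H.total hB hi hj
  unfold Ahead
  rcases hn.lt_or_gt with hl | hl <;> grind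

theorem ahead_trans (H : NumberedSchool q τ pri ν) (hB : B.card < q) (hi : i ∉ B)
    (hj : j ∉ B) (hk : k ∉ B) (hij : Ahead pri ν.num B i j) (hjk : Ahead pri ν.num B j k) :
    Ahead pri ν.num B i k := by
  have hi := isCandidate_some hi
  have hj := isCandidate_some hj
  have hk := isCandidate_some hk
  refine ⟨H.trans hB hi hj hk hij.1 hjk.1, fun hki => ?_⟩
  exact (hij.2 (H.trans hB hj hk hi hjk.1 hki)).trans (hjk.2 (H.trans hB hk hi hj hki hij.1))

/-- PD survives tie-breaking: its weak half transfers the comparison, and its strict half ensures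
that a tie at `B'` was already a tie at `B`, broken by the same numbers. -/
theorem ahead_of_typeCount_le (H : NumberedSchool q τ pri ν) (hB : B.card < q)
    (hB' : B'.card < q) (hi : i ∉ B) (hj : j ∉ B) (hi' : i ∉ B') (hj' : j ∉ B')
    (hci : typeCount τ B' (τ (some i)) ≤ typeCount τ B (τ (some i)))
    (hcj : typeCount τ B (τ (some j)) ≤ typeCount τ B' (τ (some j)))
    (h : Ahead pri ν.num B i j) : Ahead pri ν.num B' i j := by
  have hpd := H.pd B B' (some i) (some j) hB hB' (isCandidate_some hi) (isCandidate_some hj)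
    (isCandidate_some hi') (isCandidate_some hj') hci hcj
  refine ⟨hpd.2 h.1, fun hji => ?_⟩
  by_contra hn
  exact (hpd.1 ⟨h.1, fun hji' => hn (h.2 hji')⟩).2 hji

theorem acceptable_of_typeCount_le (H : NumberedSchool q τ pri ν) (hB : B.card < q)
    (hB' : B'.card < q) (hi : i ∉ B) (hi' : i ∉ B')
    (hc : typeCount τ B' (τ (some i)) ≤ typeCount τ B (τ (some i)))
    (h : pri B (some i) none) : pri B' (some i) none :=
  (H.pd B B' (some i) none hB hB' (isCandidate_some hi) isCandidate_none
    (isCandidate_some hi') isCandidate_none hc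
    (by rw [typeCount_none H.none_ne, typeCount_none H.none_ne])).2 h

/-- Distributional consistency for weak priorities: within a type, the student who comes first can
take the place of a later one. -/
theorem pri_of_swap_left (H : NumberedSchool q τ pri ν) {x : Option I}
    (hi : (insert i J).card < q) (hj : (insert j J).card < q) (hiJ : i ∉ J) (hjJ : j ∉ J)
    (hx : IsCandidate J x) (hxi : x ≠ some i) (hxj : x ≠ some j) (ht : τ (some i) = τ (some j))
    (hn : ν.num i < ν.num j) (h : pri (insert i J) (some j) x) :
    pri (insert j J) (some i) x := by
  have hJ : J.card < q := (Finset.card_le_card (Finset.subset_insert i J)).trans_lt hi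
  have hdc := H.dc J i j x hi hj (fun h => by simp [h] at hn) hiJ hjJ hx hxi hxj ht
    (H.compat.within_type i j ht hn J hJ hiJ hjJ)
  by_cases hx' : pri (insert i J) x (some j)
  · exact hdc.2.1 ⟨h, hx'⟩
  · exact (hdc.1 ⟨h, hx'⟩).1

theorem strictPri_of_swap_left (H : NumberedSchool q τ pri ν) {x : Option I}
    (hi : (insert i J).card < q) (hj : (insert j J).card < q) (hiJ : i ∉ J) (hjJ : j ∉ J)
    (hx : IsCandidate J x) (hxi : x ≠ some i) (hxj : x ≠ some j) (ht : τ (some i) = τ (some j))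
    (hn : ν.num i < ν.num j) (h : StrictPri pri (insert i J) (some j) x) :
    StrictPri pri (insert j J) (some i) x := by
  have hJ : J.card < q := (Finset.card_le_card (Finset.subset_insert i J)).trans_lt hi
  exact (H.dc J i j x hi hj (fun h => by simp [h] at hn) hiJ hjJ hx hxi hxj ht
    (H.compat.within_type i j ht hn J hJ hiJ hjJ)).1 h

theorem strictPri_of_swap_right (H : NumberedSchool q τ pri ν) {x : Option I}
    (hi : (insert i J).card < q) (hj : (insert j J).card < q) (hiJ : i ∉ J) (hjJ : j ∉ J)
    (hx : IsCandidate J x) (hxi : x ≠ some i) (hxj : x ≠ some j) (ht : τ (some i) = τ (some j))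
    (hn : ν.num i < ν.num j) (h : StrictPri pri (insert j J) x (some i)) :
    StrictPri pri (insert i J) x (some j) := by
  have hJ : J.card < q := (Finset.card_le_card (Finset.subset_insert i J)).trans_lt hi
  exact (H.dc J i j x hi hj (fun h => by simp [h] at hn) hiJ hjJ hx hxi hxj ht
    (H.compat.within_type i j ht hn J hJ hiJ hjJ)).2.2 h

theorem ahead_of_swap_left (H : NumberedSchool q τ pri ν)
    (hi : (insert i J).card < q) (hj : (insert j J).card < q) (hiJ : i ∉ J) (hjJ : j ∉ J)
    (hkJ : k ∉ J) (ht : τ (some i) = τ (some j)) (hk : τ (some i) ≠ τ (some k))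
    (hn : ν.num i < ν.num j) (h : Ahead pri ν.num (insert i J) j k) :
    Ahead pri ν.num (insert j J) i k := by
  have hki : some k ≠ some i := fun e => hk (by rw [e])
  have hkj : some k ≠ some j := fun e => hk (by rw [e, ht])
  refine ⟨H.pri_of_swap_left hi hj hiJ hjJ (isCandidate_some hkJ) hki hkj ht hn h.1, fun h' => ?_⟩
  by_contra hc
  refine (H.strictPri_of_swap_left hi hj hiJ hjJ (isCandidate_some hkJ) hki hkj ht hn
    ⟨h.1, fun h'' => hc ?_⟩).2 h'
  exact H.num_lt_of_type ht.symm rfl (ht ▸ hk) (h.2 h'')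

/-- The weak part is the contrapositive of the first clause of DC; the third clause excludes a new
tie that the numbers would break the wrong way. -/
theorem ahead_of_swap_right (H : NumberedSchool q τ pri ν)
    (hi : (insert i J).card < q) (hj : (insert j J).card < q) (hiJ : i ∉ J) (hjJ : j ∉ J)
    (hkJ : k ∉ J) (ht : τ (some i) = τ (some j)) (hk : τ (some i) ≠ τ (some k))
    (hn : ν.num i < ν.num j) (h : Ahead pri ν.num (insert j J) k i) :
    Ahead pri ν.num (insert i J) k j := by
  have hki : some k ≠ some i := fun e => hk (by rw [e])
  have hkj : some k ≠ some j := fun e => hk (by rw [e, ht])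
  have hij : i ≠ j := fun h => by simp [h] at hn
  have hkj' : k ∉ insert i J := by simp_all
  have hji' : j ∉ insert i J := by simp [hjJ, hij.symm]
  refine ⟨?_, fun h' => ?_⟩
  · by_contra hc
    have hjk := (H.total hi hkj' hji').resolve_left hc
    exact (H.strictPri_of_swap_left hi hj hiJ hjJ (isCandidate_some hkJ) hki hkj ht hn
      ⟨hjk, hc⟩).2 h.1
  · by_contra hc
    refine (H.strictPri_of_swap_right hi hj hiJ hjJ (isCandidate_some hkJ) hki hkj ht hn
      ⟨h.1, fun h'' => hc ?_⟩).2 h'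
    exact H.num_lt_of_type rfl ht hk.symm (h.2 h'')

end NumberedSchool

/-- The priority of `i` over `j` within `K`, ties being broken by the numbering. -/
def AheadIn {I : Type*} [DecidableEq I] {n : ℕ} (pri : PriorityProfile I) (num : I ≃ Fin n)
    (K : Finset I) (i j : I) : Prop :=
  Ahead pri num (K \ {i, j}) i j

/-! ### Transitivity of priority within a set of at most `q + 1` students. -/

namespace NumberedSchool

theorem aheadIn_total (H : NumberedSchool q τ pri ν) (hK : K.card ≤ q + 1) (hi : i ∈ K)
    (hj : j ∈ K) (hij : i ≠ j) : AheadIn pri ν.num K i j ∨ AheadIn pri ν.num K j i := by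
  unfold AheadIn
  rw [Finset.pair_comm j i]
  exact H.ahead_total (card_sdiff_pair_lt hK hi hj hij) (by simp) (by simp) hij

theorem aheadIn_iff_num_lt (H : NumberedSchool q τ pri ν) (hK : K.card ≤ q + 1) (hi : i ∈ K)
    (hj : j ∈ K) (hij : i ≠ j) (ht : τ (some i) = τ (some j)) :
    AheadIn pri ν.num K i j ↔ ν.num i < ν.num j :=
  have hc := card_sdiff_pair_lt hK hi hj hij
  ⟨H.num_lt_of_ahead hc (by simp) (by simp) ht, H.ahead_of_num_lt hc (by simp) (by simp) ht⟩

theorem aheadIn_of_swap_left (H : NumberedSchool q τ pri ν) (hK : K.card ≤ q + 1) (hi : i ∈ K)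
    (hj : j ∈ K) (hk : k ∈ K) (hij : τ (some i) = τ (some j)) (hik : τ (some i) ≠ τ (some k))
    (hn : ν.num i < ν.num j) (h : AheadIn pri ν.num K j k) : AheadIn pri ν.num K i k := by
  have h1 : i ≠ k := fun e => hik (by rw [e])
  have h2 : j ≠ k := fun e => hik (by rw [hij, e])
  have h3 : i ≠ j := fun h => by simp [h] at hn
  have e1 : insert i (K \ {i, j, k}) = K \ {j, k} := by ext x; simp; grind
  have e2 : insert j (K \ {i, j, k}) = K \ {i, k} := by ext x; simp; grind
  unfold AheadIn at *
  rw [← e1] at h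
  rw [← e2]
  refine H.ahead_of_swap_left ?_ ?_ (by simp) (by simp) (by simp) hij hik hn h
  · rw [e1]; exact card_sdiff_pair_lt hK hj hk h2
  · rw [e2]; exact card_sdiff_pair_lt hK hi hk h1

theorem aheadIn_of_swap_right (H : NumberedSchool q τ pri ν) (hK : K.card ≤ q + 1) (hi : i ∈ K)
    (hj : j ∈ K) (hk : k ∈ K) (hij : τ (some i) = τ (some j)) (hik : τ (some i) ≠ τ (some k))
    (hn : ν.num i < ν.num j) (h : AheadIn pri ν.num K k i) : AheadIn pri ν.num K k j := by
  have h1 : i ≠ k := fun e => hik (by rw [e])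
  have h2 : j ≠ k := fun e => hik (by rw [hij, e])
  have h3 : i ≠ j := fun h => by simp [h] at hn
  have e1 : insert i (K \ {i, j, k}) = K \ {k, j} := by ext x; simp; grind
  have e2 : insert j (K \ {i, j, k}) = K \ {k, i} := by ext x; simp; grind
  unfold AheadIn at *
  rw [← e2] at h
  rw [← e1]
  refine H.ahead_of_swap_right ?_ ?_ (by simp) (by simp) (by simp) hij hik hn h
  · rw [e1]; exact card_sdiff_pair_lt hK hk hj h2.symm
  · rw [e2]; exact card_sdiff_pair_lt hK hk hi h1.symm

/-- The three comparisons use three different assigned sets. If two of the students share a type, DC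
swaps them; if all types differ, PD reduces everything to one common set. -/
theorem aheadIn_trans (H : NumberedSchool q τ pri ν) (hK : K.card ≤ q + 1) (hi : i ∈ K)
    (hj : j ∈ K) (hk : k ∈ K) (hij : i ≠ j) (hjk : j ≠ k) (hik : i ≠ k)
    (h1 : AheadIn pri ν.num K i j) (h2 : AheadIn pri ν.num K j k) :
    AheadIn pri ν.num K i k := by
  by_cases tij : τ (some i) = τ (some j)
  · have n1 := (H.aheadIn_iff_num_lt hK hi hj hij tij).1 h1
    by_cases tjk : τ (some j) = τ (some k)
    · have n2 := (H.aheadIn_iff_num_lt hK hj hk hjk tjk).1 h2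
      exact (H.aheadIn_iff_num_lt hK hi hk hik (tij.trans tjk)).2 (n1.trans n2)
    · exact H.aheadIn_of_swap_left hK hi hj hk tij (tij ▸ tjk) n1 h2
  by_cases tjk : τ (some j) = τ (some k)
  · have n2 := (H.aheadIn_iff_num_lt hK hj hk hjk tjk).1 h2
    exact H.aheadIn_of_swap_right hK hj hk hi tjk (Ne.symm tij) n2 h1
  by_cases tik : τ (some i) = τ (some k)
  · refine (H.aheadIn_iff_num_lt hK hi hk hik tik).2 ?_
    by_contra hn
    have hn : ν.num k < ν.num i := lt_of_le_of_ne (not_lt.1 hn)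
      fun e => hik (ν.num.injective e).symm
    have h3 := H.aheadIn_of_swap_left hK hk hi hj tik.symm (Ne.symm tjk) hn h1
    unfold AheadIn at h2 h3
    rw [Finset.pair_comm] at h3
    exact h2.asymm h3
  -- Three distinct types: for each pair, also removing the third student leaves the counts of the
  -- two compared types unchanged, so PD moves comparisons to and from `K \ {i, j, k}`.
  have c0 : (K \ {i, j, k}).card < q :=
    (Finset.card_le_card (by intro x; simp; grind)).trans_lt (card_sdiff_pair_lt hK hi hj hij)
  have c1 := card_sdiff_pair_lt hK hi hj hij
  have c2 := card_sdiff_pair_lt hK hj hk hjk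
  have c3 := card_sdiff_pair_lt hK hi hk hik
  refine H.ahead_of_typeCount_le c0 c3 (by simp) (by simp) (by simp) (by simp)
    (typeCount_le (by intro x; simp; grind)) (typeCount_le (by intro x; simp; grind))
    (H.ahead_trans c0 (j := j) (by simp) (by simp) (by simp) ?_ ?_)
  · exact H.ahead_of_typeCount_le c1 c0 (by simp) (by simp) (by simp) (by simp)
      (typeCount_le (by intro x; simp; grind)) (typeCount_le (by intro x; simp; grind)) h1
  · exact H.ahead_of_typeCount_le c2 c0 (by simp) (by simp) (by simp) (by simp)
      (typeCount_le (by intro x; simp; grind)) (typeCount_le (by intro x; simp; grind)) h2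

/-- Every nonempty subset of a set of at most `q + 1` students has a last member. -/
theorem exists_last (H : NumberedSchool q τ pri ν) (hK : K.card ≤ q + 1) (L : Finset I)
    (hL : L.Nonempty) (hLK : L ⊆ K) :
    ∃ r ∈ L, ∀ j ∈ L, j ≠ r → AheadIn pri ν.num K j r := by
  induction hL using Finset.Nonempty.cons_induction with
  | singleton a => exact ⟨a, by simp, by simp⟩
  | cons a s ha hs ih =>
    rw [Finset.cons_eq_insert, Finset.insert_subset_iff] at hLK
    obtain ⟨r, hr, hr'⟩ := ih hLK.2
    have har : a ≠ r := fun e => ha (e ▸ hr)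
    rcases H.aheadIn_total hK hLK.1 (hLK.2 hr) har with h | h
    · refine ⟨r, by simp [hr], fun j hj hjr => ?_⟩
      rcases Finset.mem_cons.1 hj with rfl | hj
      · exact h
      · exact hr' j hj hjr
    · refine ⟨a, by simp, fun j hj hja => ?_⟩
      replace hj := (Finset.mem_cons.1 hj).resolve_left hja
      by_cases hjr : j = r
      · exact hjr ▸ h
      · exact H.aheadIn_trans hK (hLK.2 hj) (hLK.2 hr) hLK.1 hjr har.symm hja (hr' j hj hjr) h

end NumberedSchool

end Priorities

/-- Links the rejection rule to the tie-broken order: any other student of lowest priority is tied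
with `r`, hence has a smaller number. -/
theorem isRejected_iff {I : Type*} [DecidableEq I] {n : ℕ} {pri : PriorityProfile I}
    {num : I ≃ Fin n} {K : Finset I} {r : I} (hr : r ∈ K)
    (hlast : ∀ j ∈ K, j ≠ r → AheadIn pri num K j r) (i : I) :
    IsRejected pri num K i ↔ i = r := by
  have hlow : HasLowestPriority pri K r := by
    refine ⟨hr, fun j hj hs => ?_⟩
    by_cases hjr : j = r
    · exact hs.2 (hjr ▸ hs.1)
    · have := (hlast j hj hjr).1
      rw [Finset.pair_comm] at this
      exact hs.2 this
  have hmax : ∀ j, HasLowestPriority pri K j → num j ≤ num r := by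
    intro j hj
    by_cases hjr : j = r
    · rw [hjr]
    · have h1 := hlast j hj.1 hjr
      have h2 := hj.2 r hr
      exact (h1.2 (by_contra fun h3 => h2 ⟨h1.1, h3⟩)).le
  refine ⟨fun h => ?_, fun h => h ▸ ⟨hlow, hmax⟩⟩
  exact num.injective (le_antisymm (hmax i h.1) (h.2 r hlow))

/-! ### The choice function -/

/-- The conditions that characterize the choice `A` of a school from the set `J` of applicants. -/
structure IsChoice {I T : Type*} [Fintype I] [DecidableEq I] [Fintype T] (q : ℕ)
    (τ : Option I → T) (pri : PriorityProfile I) (ν : Numbering I T) (J A : Finset I) : Prop where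
  subset : A ⊆ J
  card_le : A.card ≤ q
  initial : ∀ i ∈ J, ∀ j ∈ A, τ (some i) = τ (some j) → ν.num i < ν.num j → i ∈ A
  acceptable : ∀ i ∈ A, pri (A.erase i) (some i) none
  nonwasteful : A.card < q → ∀ i ∈ J, i ∉ A → ¬ pri A (some i) none
  fair : A.card = q → ∀ i ∈ J, i ∉ A → ∀ j ∈ A, Ahead pri ν.num (A.erase j) j i

/-! ### Consequences of the choice conditions, and their preservation by each application. -/

section Choice

variable {I T : Type*} [Fintype I] [DecidableEq I] [Fintype T] {q : ℕ}
  {τ : Option I → T} {pri : PriorityProfile I} {ν : Numbering I T} {A A' J J' : Finset I}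

theorem NumberedSchool.card_erase_lt (H : NumberedSchool q τ pri ν) (hA : A.card ≤ q) (i : I)
    (hi : i ∈ A) : (A.erase i).card < q := by
  rw [Finset.card_erase_of_mem hi]
  have := H.one_le
  omega

namespace IsChoice

/-- The choice depends on the assigned set only through the type counts: a student chosen from
`J'` but not from a set `J` of applicants that contains her would violate one of the conditions. -/
theorem mem_of_mem (H : NumberedSchool q τ pri ν) (hA : IsChoice q τ pri ν J A)
    (hA' : IsChoice q τ pri ν J' A') (hJ : J ⊆ J') {i : I} (hi : i ∈ J) (hi' : i ∈ A') :
    i ∈ A := by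
  by_contra hiA
  -- Since `i` is missing from `A`, the members of `A` of her type all precede her; since she is in
  -- `A'`, they belong to `A'` too.
  have hc : typeCount τ A (τ (some i)) ≤ typeCount τ (A'.erase i) (τ (some i)) := by
    refine typeCount_le fun x hx hxt => ?_
    have hxi : x ≠ i := fun e => hiA (e ▸ hx)
    refine Finset.mem_erase.2 ⟨hxi, hA'.initial x (hJ (hA.subset hx)) i hi' hxt ?_⟩
    by_contra hn
    exact hiA (hA.initial i hi x hx hxt.symm
      (lt_of_le_of_ne (not_lt.1 hn) fun e => hxi (ν.num.injective e).symm))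
  have hce := H.card_erase_lt hA'.card_le i hi'
  rcases hA.card_le.lt_or_eq with hlt | heq
  · exact hA.nonwasteful hlt i hi hiA (H.acceptable_of_typeCount_le hce hlt (by simp) hiA hc
      (hA'.acceptable i hi'))
  -- `A` is full and `A'` has strictly more of the type of `i`, so `A'` has fewer of some other
  -- type. A student `j` of that type in `A` but not in `A'` makes fairness of `A` and of `A'`
  -- contradict each other, or else deserves a free seat of `A'`.
  · obtain ⟨u, hu⟩ : ∃ u, typeCount τ A' u < typeCount τ A u := by
      by_contra! hle
      have hlt : A.card < A'.card := by
        rw [card_eq_sum_typeCount τ A, card_eq_sum_typeCount τ A']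
        refine Finset.sum_lt_sum (fun u _ => hle u) ⟨τ (some i), Finset.mem_univ _, ?_⟩
        have := typeCount_erase_add_one (τ := τ) hi'
        omega
      have := hA'.card_le
      omega
    obtain ⟨j, hj, hj', hcj⟩ := exists_mem_of_typeCount_lt hu
    have hij : i ≠ j := fun e => hiA (e ▸ hj)
    have hje := H.card_erase_lt hA.card_le j hj
    rcases hA'.card_le.lt_or_eq with hlt' | heq'
    · exact hA'.nonwasteful hlt' j (hJ (hA.subset hj)) hj'
        (H.acceptable_of_typeCount_le hje hlt' (by simp) hj' hcj (hA.acceptable j hj))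
    · have h1 := hA.fair heq i hi hiA j hj
      refine (hA'.fair heq' j (hJ (hA.subset hj)) hj' i hi').asymm
        (H.ahead_of_typeCount_le hje hce (by simp) (by simp [hiA]) (by simp [hj']) (by simp)
        ?_ ?_ h1)
      · exact (typeCount_le fun x hx _ => Finset.mem_of_mem_erase hx).trans hcj
      · exact (typeCount_le fun x hx _ => Finset.mem_of_mem_erase hx).trans hc

/-- If the larger applicant set left a seat free and yet chose fewer students, some type would be
scarcer in `A'`; by PD a student of that type in `A` would be acceptable for the free seat. -/
theorem card_mono (H : NumberedSchool q τ pri ν) (hA : IsChoice q τ pri ν J A)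
    (hA' : IsChoice q τ pri ν J' A') (hJ : J ⊆ J') : A.card ≤ A'.card := by
  rcases hA'.card_le.lt_or_eq with hlt' | heq'
  · by_contra! hlt
    obtain ⟨u, hu⟩ : ∃ u, typeCount τ A' u < typeCount τ A u := by
      by_contra! hle
      rw [card_eq_sum_typeCount τ A, card_eq_sum_typeCount τ A'] at hlt
      exact absurd (Finset.sum_le_sum fun u _ => hle u) hlt.not_ge
    obtain ⟨j, hj, hj', hcj⟩ := exists_mem_of_typeCount_lt hu
    exact hA'.nonwasteful hlt' j (hJ (hA.subset hj)) hj'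
        (H.acceptable_of_typeCount_le (H.card_erase_lt hA.card_le j hj) hlt' (by simp) hj' hcj
          (hA.acceptable j hj))
  · exact heq' ▸ hA.card_le

theorem empty : IsChoice q τ pri ν ∅ ∅ where
  subset := subset_rfl
  card_le := by simp
  initial := by simp
  acceptable := by simp
  nonwasteful := by simp
  fair := by simp

/-- The next applicant gets a free seat. -/
theorem insert_of_acceptable (H : NumberedSchool q τ pri ν) (hA : IsChoice q τ pri ν J A)
    {a : I} (ha : ∀ j ∈ J, ν.num j < ν.num a) (hlt : A.card < q) (hacc : pri A (some a) none) :
    IsChoice q τ pri ν (insert a J) (insert a A) := by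
  have haJ : a ∉ J := fun h => lt_irrefl _ (ha a h)
  have haA : a ∉ A := fun h => haJ (hA.subset h)
  have hle : (insert a A).card ≤ q := by rw [Finset.card_insert_of_notMem haA]; omega
  -- An earlier student of the type of `a` has at least the priority of `a`, so she would have been
  -- acceptable.
  have htype : ∀ i ∈ J, i ∉ A → τ (some i) ≠ τ (some a) := fun i hi hiA ht =>
    hA.nonwasteful hlt i hi hiA (H.trans hlt (isCandidate_some hiA) (isCandidate_some haA)
      isCandidate_none (H.compat.within_type i a ht (ha i hi) A hlt hiA haA) hacc)
  have hreject : ∀ i ∈ J, i ∉ A → ∀ B : Finset I, B.card < q → i ∉ B →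
      typeCount τ A (τ (some i)) ≤ typeCount τ B (τ (some i)) → ¬ pri B (some i) none :=
    fun i hi hiA B hB hiB hc h => hA.nonwasteful hlt i hi hiA
      (H.acceptable_of_typeCount_le hB hlt hiB hiA hc h)
  have hinit : ∀ i ∈ insert a J, ∀ j ∈ insert a A, τ (some i) = τ (some j) →
      ν.num i < ν.num j → i ∈ insert a A := by
    intro i hi j hj ht hn
    rcases Finset.mem_insert.1 hi with rfl | hiJ
    · simp
    refine Finset.mem_insert_of_mem ?_
    rcases Finset.mem_insert.1 hj with rfl | hj
    · by_contra hiA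
      exact htype i hiJ hiA ht
    · exact hA.initial i hiJ j hj ht hn
  have hacc' : ∀ i ∈ insert a A, pri ((insert a A).erase i) (some i) none := by
    intro i hi
    rcases Finset.mem_insert.1 hi with rfl | hiA
    · rwa [Finset.erase_insert haA]
    have hia : a ≠ i := fun e => haA (e ▸ hiA)
    have hc1 := H.card_erase_lt hle i hi
    rw [Finset.erase_insert_of_ne hia] at hc1 ⊢
    -- For equal types, DC with `∅` as third element lets `i` replace the acceptable `a`; otherwise
    -- adding `a` does not change the count of the type of `i`.
    by_cases ht : τ (some i) = τ (some a)
    · refine H.pri_of_swap_left (J := A.erase i) (by rwa [Finset.insert_erase hiA]) hc1 (by simp)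
        (by simp [haA]) isCandidate_none (by simp) (by simp) ht (ha i (hA.subset hiA)) ?_
      rwa [Finset.insert_erase hiA]
    · refine H.acceptable_of_typeCount_le (H.card_erase_lt hA.card_le i hiA) hc1 (by simp)
        (by simp [hia.symm]) (typeCount_le fun x hx hxt => ?_) (hA.acceptable i hiA)
      exact (Finset.mem_insert.1 hx).resolve_left fun e => ht (by rw [← hxt, e])
  refine ⟨Finset.insert_subset_insert a hA.subset, hle, hinit, hacc', fun hlt' i hi hiA' => ?_,
    fun _ i hi hiA' j hj => ?_⟩
  all_goals
    have hia : i ≠ a := fun e => hiA' (by simp [e])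
    replace hi := (Finset.mem_insert.1 hi).resolve_left hia
    have hiA : i ∉ A := fun h => hiA' (by simp [h])
  · exact hreject i hi hiA _ hlt' hiA' (typeCount_le fun x hx _ => by simp [hx])
  · have hc := H.card_erase_lt hle j hj
    have hie : i ∉ (insert a A).erase j := fun h => hiA' (Finset.mem_of_mem_erase h)
    have hij : i ≠ j := fun e => hiA' (e ▸ hj)
    by_cases ht : τ (some i) = τ (some j)
    · refine H.ahead_of_num_lt hc (by simp) hie ht.symm ?_
      by_contra hn
      exact hiA' (hinit i (by simp [hi]) j hj ht
        (lt_of_le_of_ne (not_lt.1 hn) fun e => hij (ν.num.injective e)))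
    -- Removing `j` leaves the type of `i` undiminished, so `i` stays unacceptable while `j` is
    -- acceptable: `∅` separates them.
    · have hno := hreject i hi hiA _ hc hie (typeCount_le fun x hx hxt => by
        simp only [Finset.mem_erase, Finset.mem_insert, hx, or_true, and_true]
        rintro rfl
        exact ht hxt.symm)
      have hci := isCandidate_some hie
      have hcj : IsCandidate ((insert a A).erase j) (some j) := isCandidate_some (by simp)
      have hnij : ¬ pri ((insert a A).erase j) (some i) (some j) := fun h =>
        hno (H.trans hc hci hcj isCandidate_none h (hacc' j hj))
      exact ⟨(H.total hc (by simp) hie).resolve_right hnij, fun h => absurd h hnij⟩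

/-- The next applicant finds a free seat but is unacceptable. -/
theorem insert_of_not_acceptable (hA : IsChoice q τ pri ν J A) {a : I}
    (ha : ∀ j ∈ J, ν.num j < ν.num a) (hlt : A.card < q) (hacc : ¬ pri A (some a) none) :
    IsChoice q τ pri ν (insert a J) A where
  subset := hA.subset.trans (Finset.subset_insert a J)
  card_le := hA.card_le
  initial i hi j hj ht hn := by
    rcases Finset.mem_insert.1 hi with rfl | hi
    · exact absurd hn (ha j (hA.subset hj)).not_gt
    · exact hA.initial i hi j hj ht hn
  acceptable := hA.acceptable
  nonwasteful _ i hi hiA := by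
    rcases Finset.mem_insert.1 hi with rfl | hi
    · exact hacc
    · exact hA.nonwasteful hlt i hi hiA
  fair heq := absurd heq hlt.ne

/-- All seats are taken, and the last student of the enlarged set is rejected. -/
theorem erase_last (H : NumberedSchool q τ pri ν) (hA : IsChoice q τ pri ν J A)
    {a r : I} (ha : ∀ j ∈ J, ν.num j < ν.num a) (heq : A.card = q) (hr : r ∈ insert a A)
    (hlast : ∀ j ∈ insert a A, j ≠ r → AheadIn pri ν.num (insert a A) j r) :
    IsChoice q τ pri ν (insert a J) ((insert a A).erase r) := by
  have haJ : a ∉ J := fun h => lt_irrefl _ (ha a h)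
  have haA : a ∉ A := fun h => haJ (hA.subset h)
  have hK : (insert a A).card = q + 1 := by rw [Finset.card_insert_of_notMem haA, heq]
  have hcard : ((insert a A).erase r).card = q := by rw [Finset.card_erase_of_mem hr, hK]; rfl
  have herase : ∀ j, insert a A \ {j, r} = ((insert a A).erase r).erase j := by
    intro j; ext x; simp; grind
  have hlast' : ∀ j ∈ (insert a A).erase r,
      Ahead pri ν.num (((insert a A).erase r).erase j) j r := by
    intro j hj
    have := hlast j (Finset.mem_of_mem_erase hj) (Finset.ne_of_mem_erase hj)
    rwa [AheadIn, herase] at this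
  have hsub : (insert a A).erase r ⊆ insert a J :=
    (Finset.erase_subset _ _).trans (Finset.insert_subset_insert a hA.subset)
  -- The newcomer has the largest number, so nobody of her type can be behind her.
  have hcase : r = a ∨ (r ∈ A ∧ τ (some r) ≠ τ (some a)) := by
    rcases Finset.mem_insert.1 hr with h | h
    · exact Or.inl h
    · refine Or.inr ⟨h, fun ht => ?_⟩
      have hra : a ≠ r := fun e => haA (e ▸ h)
      exact lt_asymm (ha r (hA.subset h)) ((H.aheadIn_iff_num_lt hK.le (by simp) hr hra ht.symm).1
        (hlast a (by simp) hra))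
  have hacc : ∀ i ∈ (insert a A).erase r,
      pri (((insert a A).erase r).erase i) (some i) none := by
    intro i hi
    rcases hcase with rfl | ⟨hrA, hta⟩
    · rw [Finset.erase_insert haA] at hi ⊢
      exact hA.acceptable i hi
    · have hc := H.card_erase_lt hcard.le i hi
      have hre : r ∉ ((insert a A).erase r).erase i := by simp
      refine H.trans hc (isCandidate_some (by simp)) (isCandidate_some hre) isCandidate_none
        (hlast' i hi).1 (H.acceptable_of_typeCount_le (H.card_erase_lt heq.le r hrA) hc (by simp)
          hre (typeCount_le fun x hx hxt => ?_) (hA.acceptable r hrA))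
      simp only [Finset.mem_erase, Finset.mem_insert] at hx ⊢
      exact ⟨hx.2.1, hx.2.2.resolve_left fun e => hta (by rw [← hxt, e])⟩
  have hfair : ∀ i ∈ insert a J, i ∉ (insert a A).erase r → ∀ j ∈ (insert a A).erase r,
      Ahead pri ν.num (((insert a A).erase r).erase j) j i := by
    intro i hi hiA j hj
    by_cases hir : i = r
    · exact hir ▸ hlast' j hj
    have hc := H.card_erase_lt hcard.le j hj
    have hiK : i ∉ insert a A := fun h => hiA (Finset.mem_erase.2 ⟨hir, h⟩)
    have hia : i ≠ a := fun e => hiK (by simp [e])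
    replace hi := (Finset.mem_insert.1 hi).resolve_left hia
    replace hiA : i ∉ A := fun h => hiK (by simp [h])
    rcases hcase with rfl | ⟨hrA, hta⟩
    · rw [Finset.erase_insert haA] at hj ⊢
      exact hA.fair heq i hi hiA j hj
    have hie : i ∉ ((insert a A).erase r).erase j := by simp [hia, hiA]
    -- Numbers settle this case. Otherwise, including `j = a`, the comparison goes through `r`: `j`
    -- is ahead of `r`, and PD transfers the old priority of `r` over `i`.
    by_cases htij : j ∈ A ∧ τ (some j) = τ (some i)
    · refine H.ahead_of_num_lt hc (by simp) hie htij.2 ?_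
      by_contra hn
      exact hiA (hA.initial i hi j htij.1 htij.2.symm
        (lt_of_le_of_ne (not_lt.1 hn) fun e => hiA (ν.num.injective e ▸ htij.1)))
    · refine H.ahead_trans hc (j := r) (by simp) (by simp) hie (hlast' j hj) ?_
      refine H.ahead_of_typeCount_le (H.card_erase_lt heq.le r hrA) hc (by simp) (by simp [hiA])
        (by simp) hie (typeCount_le fun x hx hxt => ?_) (typeCount_le fun x hx hxt => ?_)
        (hA.fair heq i hi hiA r hrA)
      · simp only [Finset.mem_erase, Finset.mem_insert] at hx ⊢
        exact ⟨hx.2.1, hx.2.2.resolve_left fun e => hta (by rw [← hxt, e])⟩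
      · simp only [Finset.mem_erase, Finset.mem_insert] at hx ⊢
        exact ⟨fun e => htij ⟨e ▸ hx.2, e ▸ hxt⟩, hx.1, Or.inr hx.2⟩
  refine ⟨hsub, hcard.le, fun i hi j hj ht hn => ?_, hacc,
    fun hlt => absurd hcard hlt.ne, fun _ => hfair⟩
  by_contra hiA
  have hc := H.card_erase_lt hcard.le j hj
  exact lt_asymm hn (H.num_lt_of_ahead hc (by simp) (fun h => hiA (Finset.mem_of_mem_erase h))
    ht.symm (hfair i hi hiA j hj))

theorem choiceStep (H : NumberedSchool q τ pri ν) (hA : IsChoice q τ pri ν J A)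
    {a : I} (ha : ∀ j ∈ J, ν.num j < ν.num a) :
    IsChoice q τ pri ν (insert a J) (SchoolChoice.choiceStep q pri ν.num A a) := by
  unfold SchoolChoice.choiceStep
  split_ifs with h1 h2
  · exact hA.insert_of_acceptable H ha h1 h2
  · exact hA.insert_of_not_acceptable ha h1 h2
  · have heq := le_antisymm hA.card_le (not_lt.1 h1)
    have hK : (insert a A).card ≤ q + 1 := heq ▸ Finset.card_insert_le a A
    obtain ⟨r, hr, hlast⟩ := H.exists_last hK (insert a A) (by simp) subset_rfl
    convert hA.erase_last H ha heq hr hlast using 1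
    ext x
    simp only [Finset.mem_filter, isRejected_iff hr hlast, Finset.mem_erase, and_comm, ne_eq]

theorem foldl (H : NumberedSchool q τ pri ν) (l : List I)
    (hl : l.Pairwise fun i j => ν.num i < ν.num j) :
    ∀ {J A : Finset I}, (∀ j ∈ J, ∀ a ∈ l, ν.num j < ν.num a) → IsChoice q τ pri ν J A →
      IsChoice q τ pri ν (J ∪ l.toFinset) (l.foldl (SchoolChoice.choiceStep q pri ν.num) A) := by
  induction l with
  | nil => intro J A _ hA; simpa using hA
  | cons a l ih =>
    intro J A hJ hA
    rw [List.pairwise_cons] at hl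
    have := ih hl.2 (J := insert a J) (fun j hj b hb => ?_)
      (hA.choiceStep H fun j hj => hJ j hj a (by simp))
    · rwa [List.toFinset_cons, Finset.union_insert, ← Finset.insert_union]
    · rcases Finset.mem_insert.1 hj with rfl | hj
      · exact hl.1 b hb
      · exact hJ j hj b (by simp [hb])

end IsChoice

theorem pairwise_applicants {I : Type*} [DecidableEq I] {n : ℕ} (num : I ≃ Fin n)
    (J : Finset I) : (applicants num J).Pairwise fun i j => num i < num j := by
  refine List.Pairwise.filter _ (List.pairwise_map.2 ?_)
  simpa using List.pairwise_lt_finRange n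

theorem toFinset_applicants {I : Type*} [DecidableEq I] {n : ℕ} (num : I ≃ Fin n)
    (J : Finset I) : (applicants num J).toFinset = J := by
  ext x
  simp only [applicants, List.mem_toFinset, List.mem_filter, List.mem_map, List.mem_finRange,
    true_and, decide_eq_true_eq, and_iff_right_iff_imp]
  exact fun _ => ⟨num x, by simp⟩

theorem NumberedSchool.isChoice_choiceFn (H : NumberedSchool q τ pri ν) (J : Finset I) :
    IsChoice q τ pri ν J (choiceFn q pri ν.num J) := by
  have := IsChoice.foldl H _ (pairwise_applicants ν.num J) (by simp) IsChoice.empty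
  rwa [toFinset_applicants, Finset.empty_union] at this

end Choice

/-! ### Substitutable choice functions -/

/-- Substitutability and the law of aggregate demand. -/
structure IsSubstitutable {I : Type*} (C : Finset I → Finset I) : Prop where
  subset : ∀ J, C J ⊆ J
  mem_of_mem : ∀ J J', J ⊆ J' → ∀ i ∈ J, i ∈ C J' → i ∈ C J
  card_mono : ∀ J J', J ⊆ J' → (C J).card ≤ (C J').card

namespace IsSubstitutable

variable {I : Type*} {C : Finset I → Finset I} {J J' : Finset I}

/-- Substitutability keeps every chosen student, and the law of aggregate demand leaves no room for
more. -/
theorem eq_of_subset (h : IsSubstitutable C) (h1 : C J ⊆ J') (h2 : J' ⊆ J) : C J' = C J :=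
  (Finset.eq_of_subset_of_card_le (fun i hi => h.mem_of_mem J' J h2 i (h1 hi) hi)
    (h.card_mono J' J h2)).symm

theorem choice_insert_choice [DecidableEq I] (h : IsSubstitutable C) (i : I) :
    C (insert i (C J)) = C (insert i J) := by
  refine h.eq_of_subset (fun x hx => ?_) (Finset.insert_subset_insert i (h.subset J))
  rcases Finset.mem_insert.1 (h.subset _ hx) with rfl | hxJ
  · simp
  · exact Finset.mem_insert_of_mem (h.mem_of_mem _ _ (Finset.subset_insert i J) x hxJ hx)

end IsSubstitutable

theorem NumberedSchool.isSubstitutable {I T : Type*} [Fintype I] [DecidableEq I] [Fintype T]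
    {q : ℕ} {τ : Option I → T} {pri : PriorityProfile I} {ν : Numbering I T}
    (H : NumberedSchool q τ pri ν) : IsSubstitutable (choiceFn q pri ν.num) where
  subset J := (H.isChoice_choiceFn J).subset
  mem_of_mem J J' h _ hi hi' :=
    (H.isChoice_choiceFn J).mem_of_mem H (H.isChoice_choiceFn J') h hi hi'
  card_mono J J' h := (H.isChoice_choiceFn J).card_mono H (H.isChoice_choiceFn J') h

/-! ### Demands of students -/

/-- A strict ranking of the schools and an upper set of acceptable schools. -/
structure Demand (S : Type*) where
  better : S → S → Prop
  acc : S → Prop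
  irrefl : ∀ s, ¬ better s s
  trans : ∀ a b c, better a b → better b c → better a c
  total : ∀ a b, a ≠ b → better a b ∨ better b a
  acc_up : ∀ a b, better a b → acc b → acc a

/-- The schools as ranked by a preference relation. -/
def Pref.demand {S : Type*} (p : Pref S) : Demand S where
  better a b := p.P (some a) (some b)
  acc a := p.R (some a) none
  irrefl _ h := h.2 rfl
  trans _ _ _ h h' := ⟨p.trans _ _ _ h.1 h'.1, fun e =>
    h.2 (p.antisymm _ _ h.1 (e ▸ h'.1))⟩
  total a b h := (p.total (some a) (some b)).imp
    (fun h' => ⟨h', fun e => h (Option.some.inj e)⟩)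
    (fun h' => ⟨h', fun e => h (Option.some.inj e.symm)⟩)
  acc_up _ _ h h' := p.trans _ _ _ h.1 h'

/-- Move the school `s` to the top. -/
def Demand.lift {S : Type*} (d : Demand S) (s : S) : Demand S where
  better a b := b ≠ s ∧ (a = s ∨ d.better a b)
  acc a := a = s ∨ d.acc a
  irrefl a h := h.2.elim h.1 (d.irrefl a)
  trans a b c h h' := ⟨h'.1, h.2.imp_right fun hab =>
    d.trans a b c hab (h'.2.resolve_left h.1)⟩
  total a b h := by
    have := d.total a b h
    grind
  acc_up a b h h' := h.2.imp_right fun hab => d.acc_up a b hab (h'.resolve_left h.1)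

/-- Make the schools below `s` unacceptable. -/
def Demand.truncate {S : Type*} (d : Demand S) (s : S) : Demand S where
  better := d.better
  acc a := a = s ∨ d.better a s
  irrefl := d.irrefl
  trans := d.trans
  total := d.total
  acc_up a b h h' := Or.inr (h'.elim (fun e => e ▸ h) (d.trans a b s h))

/-! ### The least closed set of applications -/

/-- `X` contains every application that has to be made when the applications better for the
student belong to `X` and are rejected. -/
def Closed {S I : Type*} (C : S → Finset I → Finset I) (D : I → Demand S) (X : S → Finset I) :
    Prop :=
  ∀ i s, (D i).acc s → (∀ s', (D i).better s' s → i ∈ X s' ∧ i ∉ C s' (X s')) → i ∈ X s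

/-- Changing the demands of the students in `J` only. -/
theorem Closed.of_eq_off {S I : Type*} {C : S → Finset I → Finset I} {D D' : I → Demand S}
    {X : S → Finset I} (hX : Closed C D X) (J : Set I)
    (hD : ∀ i ∉ J, D' i = D i) (hJ : ∀ j ∈ J, ∀ s, (D' j).acc s →
      (∀ s', (D' j).better s' s → j ∈ X s' ∧ j ∉ C s' (X s')) → j ∈ X s) : Closed C D' X := by
  intro i s hs h
  by_cases hi : i ∈ J
  · exact hJ i hi s hs h
  · rw [hD i hi] at hs h
    exact hX i s hs h

open Classical in
/-- The least closed set of applications. -/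
noncomputable def applications {S I : Type*} [Fintype I] (C : S → Finset I → Finset I)
    (D : I → Demand S) (s : S) : Finset I :=
  Finset.univ.filter fun i => ∀ X, Closed C D X → i ∈ X s

/-! ### The least fixed point, and its invariance under lifting rejecting schools. -/

section Applications

variable {S I : Type*} [Fintype I] {C : S → Finset I → Finset I} {D D' : I → Demand S}
  {i j : I} {s s' : S}

theorem applications_subset {X : S → Finset I} (hX : Closed C D X) (s : S) :
    applications C D s ⊆ X s := by
  intro i hi
  simp only [applications, Finset.mem_filter] at hi
  exact hi.2 X hX

/-- By substitutability a rejected applicant stays rejected in a larger set, so an intersection of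
closed families is closed. -/
theorem closed_applications (hC : ∀ s, IsSubstitutable (C s)) :
    Closed C D (applications C D) := by
  intro i s hs h
  simp only [applications, Finset.mem_filter, Finset.mem_univ, true_and]
  intro X hX
  refine hX i s hs fun s' hs' => ?_
  have h1 := h s' hs'
  have h2 := applications_subset hX s'
  exact ⟨h2 h1.1, fun h3 => h1.2 ((hC s').mem_of_mem _ _ h2 i h1.1 h3)⟩

/-- A least closed family is a fixed point, as in Knaster–Tarski: the applications it justifies form
a closed subfamily `Y`. -/
theorem mem_applications_iff (hC : ∀ s, IsSubstitutable (C s)) :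
    i ∈ applications C D s ↔ (D i).acc s ∧ ∀ s', (D i).better s' s →
      i ∈ applications C D s' ∧ i ∉ C s' (applications C D s') := by
  classical
  refine ⟨fun hi => ?_, fun h => closed_applications hC i s h.1 h.2⟩
  let Y : S → Finset I := fun s => Finset.univ.filter fun i =>
    (D i).acc s ∧ ∀ s', (D i).better s' s →
      i ∈ applications C D s' ∧ i ∉ C s' (applications C D s')
  have hYX : ∀ s, Y s ⊆ applications C D s := by
    intro s i hi
    simp only [Y, Finset.mem_filter, Finset.mem_univ, true_and] at hi
    exact closed_applications hC i s hi.1 hi.2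
  have hY : Closed C D Y := by
    intro i s hs h
    simp only [Y, Finset.mem_filter, Finset.mem_univ, true_and]
    refine ⟨hs, fun s' hs' => ?_⟩
    have h1 := h s' hs'
    exact ⟨hYX s' h1.1, fun h3 => h1.2 ((hC s').mem_of_mem _ _ (hYX s') i h1.1 h3)⟩
  have := applications_subset hY s hi
  simpa only [Y, Finset.mem_filter, Finset.mem_univ, true_and] using this

theorem eq_of_mem_choice (hC : ∀ s, IsSubstitutable (C s)) (h : i ∈ C s (applications C D s))
    (h' : i ∈ C s' (applications C D s')) : s = s' := by
  by_contra hne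
  rcases (D i).total s s' hne with hb | hb
  · exact (((mem_applications_iff hC).1 ((hC s').subset _ h')).2 s hb).2 h
  · exact (((mem_applications_iff hC).1 ((hC s).subset _ h)).2 s' hb).2 h'

theorem mem_applications_of_unmatched [Finite S] (hC : ∀ s, IsSubstitutable (C s))
    (h : ∀ s, i ∉ C s (applications C D s)) (hs : (D i).acc s) : i ∈ applications C D s := by
  have : Std.Irrefl (D i).better := ⟨(D i).irrefl⟩
  have : IsTrans S (D i).better := ⟨(D i).trans⟩
  induction s using (Finite.wellFounded_of_trans_of_irrefl (D i).better).induction with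
  | _ s ih =>
    exact closed_applications hC i s hs fun s' hs' =>
      ⟨ih s' hs' ((D i).acc_up s' s hs' hs), h s'⟩

open Classical in
theorem card_matched [Fintype S] (hC : ∀ s, IsSubstitutable (C s)) (D : I → Demand S) :
    (Finset.univ.filter fun i => ∃ s, i ∈ C s (applications C D s)).card =
      ∑ s, (C s (applications C D s)).card := by
  rw [← Finset.card_biUnion]
  · congr 1
    ext i
    simp
  · intro s _ s' _ hne
    rw [Function.onFun, Finset.disjoint_left]
    exact fun i h h' => hne (eq_of_mem_choice hC h h')

/-- If fewer applications are made under `D'` than under `D` and only the demand of `j` differs,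
then `j` is matched under `D` when she is matched under `D'`. -/
theorem exists_choice_of_subset [Fintype S] (hC : ∀ s, IsSubstitutable (C s))
    (hsub : ∀ s, applications C D' s ⊆ applications C D s)
    (hD : ∀ i, i ≠ j → D' i = D i) (hj : j ∈ C s (applications C D' s)) :
    ∃ s', j ∈ C s' (applications C D s') := by
  classical
  by_contra hno
  -- Anyone matched under `D` stays matched under `D'`: otherwise she applies to her school there
  -- too and faces less competition. With `j` in addition, strictly more students are matched under
  -- `D'`, against the law of aggregate demand.
  have hlt : (Finset.univ.filter fun i => ∃ s, i ∈ C s (applications C D s)).card <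
      (Finset.univ.filter fun i => ∃ s, i ∈ C s (applications C D' s)).card := by
    refine Finset.card_lt_card (Finset.ssubset_iff_subset_ne.2 ⟨fun i hi => ?_, fun e => ?_⟩)
    · simp only [Finset.mem_filter, Finset.mem_univ, true_and] at hi ⊢
      by_contra hun
      obtain ⟨s', hs'⟩ := hi
      have hij : i ≠ j := fun e => hno ⟨s', e ▸ hs'⟩
      have hi' := (hC s').subset _ hs'
      have hacc := ((mem_applications_iff hC).1 hi').1
      rw [← hD i hij] at hacc
      have h1 := mem_applications_of_unmatched hC (fun s hs => hun ⟨s, hs⟩) hacc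
      exact hun ⟨s', (hC s').mem_of_mem _ _ (hsub s') i h1 hs'⟩
    · have hmem : j ∈ Finset.univ.filter fun i => ∃ s, i ∈ C s (applications C D' s) := by
        simpa using ⟨s, hj⟩
      rw [← e] at hmem
      exact hno (by simpa using hmem)
  rw [card_matched hC, card_matched hC] at hlt
  exact absurd (Finset.sum_le_sum fun s _ => (hC s).card_mono _ _ (hsub s)) hlt.not_ge

open Classical in
/-- A student who is rejected by `s` is still rejected by `s` after moving `s` to the top. -/
theorem notMem_choice_of_lift [Fintype S] (hC : ∀ s, IsSubstitutable (C s))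
    (hj : j ∈ applications C D s) (hrej : j ∉ C s (applications C D s)) :
    j ∉ C s (applications C (Function.update D j ((D j).lift s)) s) := by
  intro hlift
  -- `D₂` leaves only `s` acceptable to `j`; `D₃` drops the schools below `s`. Under `D₃` she is
  -- unmatched. If `s` accepted her under `D₁`, it would accept her under `D₂`, and
  -- `exists_choice_of_subset` would match her under `D₃`.
  set D₁ := Function.update D j ((D j).lift s) with hD₁
  set D₂ := Function.update D j (((D j).lift s).truncate s) with hD₂
  set D₃ := Function.update D j ((D j).truncate s) with hD₃
  have h₁j : D₁ j = (D j).lift s := by simp [hD₁]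
  have h₂j : D₂ j = ((D j).lift s).truncate s := by simp [hD₂]
  have h₃j : D₃ j = (D j).truncate s := by simp [hD₃]
  have h₁ : ∀ i, i ≠ j → D₁ i = D i := fun i h => by simp [hD₁, h]
  have h₂ : ∀ i, i ≠ j → D₂ i = D i := fun i h => by simp [hD₂, h]
  have h₃ : ∀ i, i ≠ j → D₃ i = D i := fun i h => by simp [hD₃, h]
  have hacc := ((mem_applications_iff hC).1 hj).1
  have hacc₃ : ∀ s', (D₃ j).acc s' ↔ s' = s ∨ (D j).better s' s := by
    intro s'; rw [h₃j]; rfl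
  have hbetter₃ : (D₃ j).better = (D j).better := by rw [h₃j]; rfl
  have hacc₂ : ∀ s', (D₂ j).acc s' ↔ s' = s := by
    intro s'
    rw [h₂j]
    exact ⟨fun h => h.elim id fun h => absurd rfl h.1, Or.inl⟩
  have hsub₃ : ∀ s, applications C D₃ s ⊆ applications C D s := by
    refine applications_subset ((closed_applications hC).of_eq_off {j} (fun i hi => h₃ i hi) ?_)
    rintro _ rfl s' hs' hb
    refine closed_applications hC _ s' ?_ (hbetter₃ ▸ hb)
    rcases (hacc₃ s').1 hs' with rfl | hs'
    · exact hacc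
    · exact (D _).acc_up _ _ hs' hacc
  have hun : ∀ s', j ∉ C s' (applications C D₃ s') := by
    intro s' hs'
    have hs'₃ := (hC s').subset _ hs'
    -- If `j` is matched under `D₃`, it is at `s` or better, so the dropped schools would never be
    -- reached.
    have hsub : ∀ s, applications C D s ⊆ applications C D₃ s := by
      refine applications_subset ((closed_applications hC).of_eq_off {j}
        (fun i hi => (h₃ i hi).symm) ?_)
      rintro _ rfl t ht hb
      refine closed_applications hC _ t ((hacc₃ t).2 ?_) (hbetter₃ ▸ hb)
      by_contra hts
      push Not at hts
      have hst := ((D _).total t s hts.1).resolve_left hts.2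
      rcases (hacc₃ s').1 ((mem_applications_iff hC).1 hs'₃).1 with rfl | hs's
      · exact (hb _ hst).2 hs'
      · exact (hb _ ((D _).trans _ _ _ hs's hst)).2 hs'
    have heq : applications C D₃ = applications C D :=
      funext fun s => Finset.Subset.antisymm (hsub₃ s) (hsub s)
    rw [heq] at hs'
    rcases (hacc₃ s').1 ((mem_applications_iff hC).1 hs'₃).1 with rfl | hs's
    · exact hrej hs'
    · exact (((mem_applications_iff hC).1 hj).2 s' hs's).2 hs'
  have hsub₂₁ : ∀ s, applications C D₂ s ⊆ applications C D₁ s := by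
    refine applications_subset ((closed_applications hC).of_eq_off {j}
      (fun i hi => by rw [h₁ i hi, h₂ i hi]) ?_)
    rintro _ rfl t ht -
    obtain rfl := (hacc₂ t).1 ht
    exact (hC _).subset _ hlift
  have hsub₂₃ : ∀ s, applications C D₂ s ⊆ applications C D₃ s := by
    refine applications_subset ((closed_applications hC).of_eq_off {j}
      (fun i hi => by rw [h₂ i hi, h₃ i hi]) ?_)
    rintro _ rfl t ht -
    obtain rfl := (hacc₂ t).1 ht
    exact mem_applications_of_unmatched hC hun ((hacc₃ _).2 (Or.inl rfl))
  have hj₂ : j ∈ applications C D₂ s := by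
    refine closed_applications hC j s ((hacc₂ s).2 rfl) fun s' hs' => ?_
    rw [h₂j] at hs'
    exact absurd rfl hs'.1
  obtain ⟨s', hs'⟩ := exists_choice_of_subset hC hsub₂₃
    (fun i hi => by rw [h₂ i hi, h₃ i hi]) ((hC s).mem_of_mem _ _ (hsub₂₁ s) j hj₂ hlift)
  exact hun s' hs'

-- Each family is closed for the other demand. At `D`, student `j` has already applied to every
-- acceptable school at least as good as her match; at the lifted demand, her first application, to
-- `s`, is rejected by `notMem_choice_of_lift`.
open Classical in
theorem applications_lift [Fintype S] (hC : ∀ s, IsSubstitutable (C s))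
    (hj : j ∈ applications C D s) (hrej : j ∉ C s (applications C D s)) :
    applications C (Function.update D j ((D j).lift s)) = applications C D := by
  have hrej₁ := notMem_choice_of_lift hC hj hrej
  set D₁ := Function.update D j ((D j).lift s) with hD₁
  have h₁j : D₁ j = (D j).lift s := by simp [hD₁]
  have h₁ : ∀ i, i ≠ j → D₁ i = D i := fun i h => by simp [hD₁, h]
  have hacc := ((mem_applications_iff hC).1 hj).1
  have hj₁ : j ∈ applications C D₁ s := by
    refine closed_applications hC j s (h₁j ▸ Or.inl rfl) fun s' hs' => ?_
    rw [h₁j] at hs'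
    exact absurd rfl hs'.1
  refine funext fun t => Finset.Subset.antisymm ?_ ?_ <;> revert t
  · refine applications_subset ((closed_applications hC).of_eq_off {j} (fun i hi => h₁ i hi) ?_)
    rintro j rfl t ht hb
    rw [h₁j] at ht hb
    by_cases hts : t = s
    · rwa [hts]
    have hacct := ht.resolve_left hts
    by_contra hnt
    by_cases hm : ∃ s', j ∈ C s' (applications C D s')
    · obtain ⟨s', hs'⟩ := hm
      have hs'X := (hC s').subset _ hs'
      by_cases hs't : (D j).better s' t
      · exact (hb s' ⟨hts, Or.inr hs't⟩).2 hs'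
      · rcases eq_or_ne s' t with rfl | hne
        · exact hnt hs'X
        · exact hnt (((mem_applications_iff hC).1 hs'X).2 t
            (((D j).total s' t hne).resolve_left hs't)).1
    · exact hnt (mem_applications_of_unmatched hC (fun s hs => hm ⟨s, hs⟩) hacct)
  · refine applications_subset ((closed_applications hC).of_eq_off {j}
      (fun i hi => (h₁ i hi).symm) ?_)
    rintro _ rfl t ht hb
    by_cases hts : t = s
    · rwa [hts]
    refine closed_applications hC _ t (h₁j ▸ Or.inr ht) fun s' hs' => ?_
    rw [h₁j] at hs'
    rcases hs'.2 with rfl | hs'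
    · exact ⟨hj₁, hrej₁⟩
    · exact hb s' hs'

open Classical in
theorem applications_lift_coalition [Fintype S] (hC : ∀ s, IsSubstitutable (C s)) (f : I → S)
    (J : Finset I) (hJ : ∀ j ∈ J, j ∈ applications C D (f j) ∧
      j ∉ C (f j) (applications C D (f j))) :
    applications C (fun i => if i ∈ J then (D i).lift (f i) else D i) = applications C D := by
  induction J using Finset.induction_on with
  | empty => simp
  | insert a J ha ih =>
    have ih := ih fun j hj => hJ j (Finset.mem_insert_of_mem hj)
    have hja := hJ a (Finset.mem_insert_self a J)
    rw [← ih] at hja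
    have := applications_lift hC hja.1 hja.2
    rw [ih] at this
    rw [← this]
    congr 1
    funext i
    by_cases hia : i = a
    · subst hia
      simp [ha]
    · simp [hia]

/-- No coalition can be accepted by schools that reject its members at the true demands. -/
theorem not_profitable [Fintype S] (hC : ∀ s, IsSubstitutable (C s)) (f : I → S)
    (J : Finset I) (hne : J.Nonempty) (hD : ∀ i ∉ J, D' i = D i)
    (hJ : ∀ j ∈ J, j ∈ applications C D (f j) ∧ j ∉ C (f j) (applications C D (f j)))
    (hJ' : ∀ j ∈ J, j ∈ C (f j) (applications C D' (f j))) : False := by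
  classical
  have heq := applications_lift_coalition hC f J hJ
  set E : I → Demand S := fun i => if i ∈ J then (D i).lift (f i) else D i with hE
  -- Only rejected applications are deleted, so choices are unchanged. Under the lifted demands `E`
  -- each member starts at `f j`, which accepts her from `Y`, so `Y` is closed.
  let Y : S → Finset I := fun s => (applications C D' s).filter fun i => i ∈ J → f i = s
  have hYX : ∀ s, Y s ⊆ applications C D' s := fun s => Finset.filter_subset _ _
  have hCY : ∀ s, C s (Y s) = C s (applications C D' s) := by
    refine fun s => (hC s).eq_of_subset (fun i hi => ?_) (hYX s)
    exact Finset.mem_filter.2 ⟨(hC s).subset _ hi, fun hiJ =>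
      eq_of_mem_choice hC (hJ' i hiJ) hi⟩
  have hY : Closed C E Y := by
    intro i s hs h
    by_cases hi : i ∈ J
    · have hEi : E i = (D i).lift (f i) := by simp [hE, hi]
      rw [hEi] at hs h
      by_cases hsf : s = f i
      · rw [hsf]
        exact Finset.mem_filter.2 ⟨(hC _).subset _ (hJ' i hi), fun _ => rfl⟩
      · have := (h (f i) ⟨hsf, Or.inl rfl⟩).2
        rw [hCY] at this
        exact absurd (hJ' i hi) this
    · have hEi : E i = D' i := by simp [hE, hi, hD]
      rw [hEi] at hs h
      refine Finset.mem_filter.2 ⟨closed_applications hC i s hs fun s' hs' => ?_,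
        fun h => absurd h hi⟩
      have := h s' hs'
      rw [hCY] at this
      exact ⟨hYX s' this.1, this.2⟩
  obtain ⟨j, hj⟩ := hne
  have hEj : E j = (D j).lift (f j) := by simp [hE, hj]
  have hjX : j ∈ applications C E (f j) := by
    refine closed_applications hC j _ (hEj ▸ Or.inl rfl) fun s' hs' => ?_
    rw [hEj] at hs'
    exact absurd rfl hs'.1
  have hsub := applications_subset hY (f j)
  have hchosen := (hC (f j)).mem_of_mem _ _ hsub j hjX (by rw [hCY]; exact hJ' j hj)
  rw [heq] at hchosen
  exact (hJ j hj).2 hchosen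

end Applications

/-! ### Runs of deferred acceptance -/

section Runs

variable {S I : Type*} [DecidableEq S] [Fintype I] [DecidableEq I] {C : S → Finset I → Finset I}
  {P : I → Pref S} {σ σ' : SPDAState S I} {i : I} {s : S}

/-- The students that have applied to `s`. -/
def SPDAState.applied (σ : SPDAState S I) (s : S) : Finset I :=
  Finset.univ.filter fun i => i ∈ σ.held s ∨ s ∈ σ.rejectedBy i

theorem mem_applied : i ∈ σ.applied s ↔ i ∈ σ.held s ∨ s ∈ σ.rejectedBy i := by
  simp [SPDAState.applied]

theorem CanApply.notMem_applied (h : CanApply P σ i s) : i ∉ σ.applied s := by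
  rw [mem_applied, not_or]
  exact ⟨h.1 s, h.2.1⟩

theorem applied_applyTo_self (hC : ∀ s, IsSubstitutable (C s)) (i : I) (s : S) :
    (applyTo C σ i s).applied s = insert i (σ.applied s) := by
  ext x
  have := @(hC s).subset (insert i (σ.held s)) x
  simp only [mem_applied, applyTo, Function.update_self, Finset.mem_insert, Finset.mem_sdiff]
    at this ⊢
  split_ifs <;> grind

theorem applied_applyTo_of_ne (i : I) {s s' : S} (h : s' ≠ s) :
    (applyTo C σ i s).applied s' = σ.applied s' := by
  ext x
  simp only [mem_applied, applyTo, Function.update_of_ne h]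
  split_ifs <;> simp [h]

/-- The number of applications made so far. -/
def SPDAState.count [Fintype S] (σ : SPDAState S I) : ℕ := ∑ s, (σ.applied s).card

theorem count_le [Fintype S] (σ : SPDAState S I) :
    σ.count ≤ Fintype.card S * Fintype.card I := by
  refine (Finset.sum_le_card_nsmul _ _ (Fintype.card I) fun s _ => Finset.card_le_univ _).trans ?_
  simp

theorem SPDARound.count_lt [Fintype S] (hC : ∀ s, IsSubstitutable (C s))
    (h : SPDARound C P σ σ') : σ.count < σ'.count := by
  obtain ⟨i, s, hi, rfl⟩ := h
  refine Finset.sum_lt_sum (fun s' _ => ?_) ⟨s, Finset.mem_univ s, ?_⟩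
  · by_cases hs : s' = s
    · rw [hs, applied_applyTo_self hC]
      exact Finset.card_le_card (Finset.subset_insert _ _)
    · rw [applied_applyTo_of_ne i hs]
  · rw [applied_applyTo_self hC, Finset.card_insert_of_notMem hi.notMem_applied]
    exact Nat.lt_succ_self _

theorem spdaTerminates [Fintype S] (hC : ∀ s, IsSubstitutable (C s)) (P : I → Pref S) :
    SPDATerminates C P := by
  rintro ⟨run, -, hrun⟩
  have hle : ∀ d, d ≤ (run d).count := by
    intro d
    induction d with
    | zero => exact Nat.zero_le _
    | succ d ih => exact ih.trans_lt ((hrun d).count_lt hC)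
  have := (hle (Fintype.card S * Fintype.card I + 1)).trans (count_le _)
  omega

theorem exists_final [Fintype S] (hC : ∀ s, IsSubstitutable (C s)) (P : I → Pref S)
    (σ : SPDAState S I) :
    ∃ σ', Relation.ReflTransGen (SPDARound C P) σ σ' ∧ ¬ ∃ σ'', SPDARound C P σ' σ'' := by
  induction hn : Fintype.card S * Fintype.card I - σ.count using Nat.strong_induction_on
    generalizing σ with
  | _ n ih =>
    by_cases h : ∃ σ'', SPDARound C P σ σ''
    · obtain ⟨σ₁, h₁⟩ := h
      have hlt := h₁.count_lt hC
      have hle := count_le σ₁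
      obtain ⟨σ', h2, h3⟩ := ih _ (by omega) σ₁ rfl
      exact ⟨σ', h2.head h₁, h3⟩
    · exact ⟨σ, .refl, h⟩

/-- What holds after every round. -/
structure RunInvariant (C : S → Finset I → Finset I) (P : I → Pref S) (σ : SPDAState S I) :
    Prop where
  held_eq : ∀ s, σ.held s = C s (σ.applied s)
  not_rejected : ∀ s, ∀ i ∈ σ.held s, s ∉ σ.rejectedBy i
  upper : ∀ s, ∀ i ∈ σ.applied s, (P i).demand.acc s ∧
    ∀ s', (P i).demand.better s' s → s' ∈ σ.rejectedBy i
  subset : ∀ s, σ.applied s ⊆ applications C (fun i => (P i).demand) s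

theorem RunInvariant.init (hC : ∀ s, IsSubstitutable (C s)) :
    RunInvariant C P (SPDAState.init S I) := by
  have h : ∀ s, (SPDAState.init S I).applied s = ∅ := by
    intro s; ext i; simp [mem_applied, SPDAState.init]
  refine ⟨fun s => ?_, fun s i hi => ?_, fun s i hi => ?_, fun s => ?_⟩
  · rw [h]
    exact (Finset.subset_empty.1 ((hC s).subset ∅)).symm
  · simp [SPDAState.init] at hi
  · simp [h] at hi
  · simp [h]

theorem CanApply.rejected_of_better {S I : Type*} {P : I → Pref S} {σ : SPDAState S I} {i : I}
    {s s' : S} (h : CanApply P σ i s)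
    (hs' : (P i).demand.better s' s) : s' ∈ σ.rejectedBy i := by
  by_contra hn
  exact hs'.2 ((P i).antisymm _ _ hs'.1 (h.2.2.1 s' hn))

theorem RunInvariant.applyTo (hC : ∀ s, IsSubstitutable (C s)) (hσ : RunInvariant C P σ)
    (h : CanApply P σ i s) : RunInvariant C P (applyTo C σ i s) := by
  have hrej : ∀ j s', s' ∈ σ.rejectedBy j → s' ∈ (SchoolChoice.applyTo C σ i s).rejectedBy j := by
    intro j s' hs'
    simp only [SchoolChoice.applyTo]
    split_ifs <;> simp [hs']
  -- Path independence: forgetting earlier rejected applicants does not affect the choice.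
  have hchoice : C s (insert i (σ.held s)) = C s (insert i (σ.applied s)) := by
    rw [hσ.held_eq, (hC s).choice_insert_choice]
  refine ⟨fun s' => ?_, fun s' j hj hr => ?_, fun s' j hj => ?_, fun s' j hj => ?_⟩
  · by_cases hs : s' = s
    · subst hs
      rw [applied_applyTo_self hC, ← hchoice]
      simp [SchoolChoice.applyTo]
    · rw [applied_applyTo_of_ne i hs, ← hσ.held_eq]
      simp [SchoolChoice.applyTo, hs]
  · by_cases hs : s' = s
    · subst hs
      simp only [SchoolChoice.applyTo, Function.update_self] at hj hr
      rw [if_neg (by simp [hj])] at hr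
      rcases Finset.mem_insert.1 ((hC s').subset _ hj) with rfl | hjh
      · exact h.2.1 hr
      · exact hσ.not_rejected s' j hjh hr
    · simp only [SchoolChoice.applyTo, Function.update_of_ne hs] at hj hr
      refine hσ.not_rejected s' j hj ?_
      split_ifs at hr
      · exact (Finset.mem_insert.1 hr).resolve_left hs
      · exact hr
  · have key : j ∈ σ.applied s' → (P j).demand.acc s' ∧
        ∀ t, (P j).demand.better t s' → t ∈ (SchoolChoice.applyTo C σ i s).rejectedBy j :=
      fun hj => ⟨(hσ.upper s' j hj).1, fun t ht => hrej j t ((hσ.upper s' j hj).2 t ht)⟩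
    by_cases hs : s' = s
    · subst hs
      rw [applied_applyTo_self hC] at hj
      rcases Finset.mem_insert.1 hj with rfl | hj
      · exact ⟨h.2.2.2, fun t ht => hrej _ t (h.rejected_of_better ht)⟩
      · exact key hj
    · rw [applied_applyTo_of_ne i hs] at hj
      exact key hj
  · by_cases hs : s' = s
    · subst hs
      rw [applied_applyTo_self hC] at hj
      rcases Finset.mem_insert.1 hj with rfl | hj
      -- The better schools rejected `j` in the run, so they also reject her from the larger least
      -- closed sets.
      · refine closed_applications hC j s' h.2.2.2 fun t ht => ?_
        have hr := h.rejected_of_better ht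
        have ha : j ∈ σ.applied t := mem_applied.2 (Or.inr hr)
        refine ⟨hσ.subset t ha, fun hc => hσ.not_rejected t j ?_ hr⟩
        rw [hσ.held_eq]
        exact (hC t).mem_of_mem _ _ (hσ.subset t) j ha hc
      · exact hσ.subset s' hj
    · rw [applied_applyTo_of_ne i hs] at hj
      exact hσ.subset s' hj

theorem RunInvariant.of_reachable (hC : ∀ s, IsSubstitutable (C s))
    (h : Relation.ReflTransGen (SPDARound C P) (SPDAState.init S I) σ) : RunInvariant C P σ := by
  induction h with
  | refl => exact .init hC
  | tail _ hr ih =>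
    obtain ⟨i, s, hi, rfl⟩ := hr
    exact ih.applyTo hC hi

/-- In a final state the applications made are closed, since a missing one could be made now. By
leastness the result does not depend on the order of proposals. -/
theorem RunInvariant.applied_eq (hσ : RunInvariant C P σ)
    (hfinal : ¬ ∃ σ', SPDARound C P σ σ') :
    σ.applied = applications C (fun i => (P i).demand) := by
  refine funext fun s => Finset.Subset.antisymm (hσ.subset s) (applications_subset ?_ s)
  intro i s hs hb
  by_contra hn
  refine hfinal ⟨_, i, s, ⟨fun s' hs' => ?_, fun hr => hn (mem_applied.2 (Or.inr hr)),
    fun s' hs' => ?_, hs⟩, rfl⟩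
  · rcases eq_or_ne s' s with rfl | hne
    · exact hn (mem_applied.2 (Or.inl hs'))
    rcases (P i).demand.total s' s hne with h | h
    · exact (hb s' h).2 (hσ.held_eq s' ▸ hs')
    · exact hn (mem_applied.2 (Or.inr ((hσ.upper s' i (mem_applied.2 (Or.inl hs'))).2 s h)))
  · by_contra hR
    have hR' := ((P i).total _ _).resolve_left hR
    have h := hb s' ⟨hR', fun e => hR (e ▸ hR')⟩
    rw [← hσ.held_eq] at h
    exact hs' ((mem_applied.1 h.1).resolve_left h.2)

variable {q : S → ℕ} {μ : Matching S I q}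

theorem IsSPDAOutcome.students_eq (hC : ∀ s, IsSubstitutable (C s)) (h : IsSPDAOutcome C P μ)
    (s : S) : μ.students s = C s (applications C (fun i => (P i).demand) s) := by
  obtain ⟨σ, hσ, hfinal, hμ⟩ := h
  have hinv := RunInvariant.of_reachable hC hσ
  rw [hμ, hinv.held_eq, hinv.applied_eq hfinal]

theorem Matching.ext_students {S I : Type*} {q : S → ℕ} {μ μ' : Matching S I q}
    (h : ∀ s, μ.students s = μ'.students s) : μ = μ' := by
  have h1 : μ.students = μ'.students := funext h
  have h2 : μ.school = μ'.school := by
    funext i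
    refine Option.ext fun s => ?_
    rw [μ.mem_iff, μ'.mem_iff, h1]
  cases μ; cases μ'
  simp_all

theorem existsUnique_outcome [Fintype S] (hC : ∀ s, IsSubstitutable (C s))
    (hq : ∀ s J, (C s J).card ≤ q s) (P : I → Pref S) :
    ∃! μ : Matching S I q, IsSPDAOutcome C P μ := by
  classical
  refine existsUnique_of_exists_of_unique ?_ fun μ μ' h h' => Matching.ext_students fun s => by
    rw [h.students_eq hC, h'.students_eq hC]
  obtain ⟨σ, hσ, hfinal⟩ := exists_final hC P (SPDAState.init S I)
  have hinv := RunInvariant.of_reachable hC hσ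
  have happ := hinv.applied_eq hfinal
  have huniq : ∀ i s s', i ∈ σ.held s → i ∈ σ.held s' → s = s' := by
    intro i s s' h h'
    rw [hinv.held_eq, happ] at h h'
    exact eq_of_mem_choice hC h h'
  refine ⟨⟨fun i => if h : ∃ s, i ∈ σ.held s then some h.choose else none, σ.held,
    fun i s => ?_, fun s => hinv.held_eq s ▸ hq s _⟩, σ, hσ, hfinal, fun s => rfl⟩
  split_ifs with h
  · rw [Option.some_inj]
    exact ⟨fun e => e ▸ h.choose_spec, fun h' => huniq _ _ _ h.choose_spec h'⟩
  · simpa using fun h' => h ⟨s, h'⟩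

/-! ### Properties of the outcome -/

theorem IsSPDAOutcome.school_eq_some_iff (hC : ∀ s, IsSubstitutable (C s))
    (h : IsSPDAOutcome C P μ) :
    μ.school i = some s ↔ i ∈ C s (applications C (fun i => (P i).demand) s) := by
  rw [μ.mem_iff, h.students_eq hC]

theorem IsSPDAOutcome.rational (hC : ∀ s, IsSubstitutable (C s)) (h : IsSPDAOutcome C P μ)
    (i : I) : (P i).R (μ.school i) none := by
  cases hs : μ.school i with
  | none => exact ((P i).total _ _).elim id id
  | some s =>
    exact ((mem_applications_iff hC).1 ((hC s).subset _ ((h.school_eq_some_iff hC).1 hs))).1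

/-- A student has applied to every school that she prefers to the outcome. -/
theorem IsSPDAOutcome.rejected_of_better [Finite S] (hC : ∀ s, IsSubstitutable (C s))
    (h : IsSPDAOutcome C P μ) (hs : (P i).P (some s) (μ.school i)) :
    i ∈ applications C (fun i => (P i).demand) s ∧
      i ∉ C s (applications C (fun i => (P i).demand) s) := by
  have hno : i ∉ C s (applications C (fun i => (P i).demand) s) :=
    fun h' => hs.2 ((h.school_eq_some_iff hC).2 h').symm
  refine ⟨?_, hno⟩
  cases hs' : μ.school i with
  | none =>
    refine mem_applications_of_unmatched hC (fun t ht => ?_) ?_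
    · rw [(h.school_eq_some_iff hC).2 ht] at hs'
      cases hs'
    · rw [hs'] at hs
      exact hs.1
  | some s' =>
    have := (hC s').subset _ ((h.school_eq_some_iff hC).1 hs')
    rw [hs'] at hs
    exact (((mem_applications_iff hC).1 this).2 s hs).1

theorem groupStrategyProof_of_isSPDAOutcome [Fintype S] (hC : ∀ s, IsSubstitutable (C s))
    (φ : Mechanism S I q) (hφ : ∀ P, IsSPDAOutcome C P (φ P)) : GroupStrategyProof φ := by
  rintro P ⟨J, P', hne, hP', hJ⟩
  have hsome : ∀ j, ∃ s, j ∈ J → (φ P').school j = some s := by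
    intro j
    by_cases hj : j ∈ J
    · cases hs : (φ P').school j with
      | none =>
        have := hJ j hj
        rw [hs] at this
        exact absurd ((P j).antisymm _ _ this.1 ((hφ P).rational hC j)) this.2
      | some s => exact ⟨s, fun _ => rfl⟩
    -- Outside `J` any value of `f` serves; the school of a coalition member provides one.
    · obtain ⟨i, hi⟩ := hne
      cases hs : (φ P').school i with
      | none =>
        have := hJ i hi
        rw [hs] at this
        exact absurd ((P i).antisymm _ _ this.1 ((hφ P).rational hC i)) this.2
      | some s => exact ⟨s, fun h => absurd h hj⟩
  choose f hf using hsome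
  refine not_profitable (C := C) (D := fun i => (P i).demand) (D' := fun i => (P' i).demand) hC f J
    hne (fun i hi => by rw [hP' i hi]) (fun j hj => ?_) (fun j hj => ?_)
  · refine (hφ P).rejected_of_better hC ?_
    rw [← hf j hj]
    exact hJ j hj
  · exact ((hφ P').school_eq_some_iff hC).1 (hf j hj)

end Runs

theorem IsSPDAOutcome.stable {S I T : Type*} [Fintype S] [DecidableEq S] [Fintype I]
    [DecidableEq I] [Fintype T] {q : S → ℕ} {τ : S → Option I → T} {pri : S → PriorityProfile I}
    {ν : S → Numbering I T} {C : S → Finset I → Finset I} {P : I → Pref S} {μ : Matching S I q}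
    (H : ∀ s, NumberedSchool (q s) (τ s) (pri s) (ν s)) (hC : ∀ s, IsSubstitutable (C s))
    (hchoice : ∀ s J, IsChoice (q s) (τ s) (pri s) (ν s) J (C s J)) (h : IsSPDAOutcome C P μ) :
    Stable pri P μ := by
  set X := applications C (fun i => (P i).demand) with hX
  have hμ : ∀ s, IsChoice (q s) (τ s) (pri s) (ν s) (X s) (μ.students s) := fun s => by
    rw [h.students_eq hC]
    exact hchoice s _
  have hblock : ∀ i s, (P i).P (some s) (μ.school i) → i ∈ X s ∧ i ∉ μ.students s :=
    fun i s hs => by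
      rw [h.students_eq hC]
      exact h.rejected_of_better hC hs
  refine ⟨fun i s hs => ?_, ⟨h.rational hC, fun s i hi => ?_⟩, ?_⟩
  · obtain ⟨hi, hi'⟩ := hblock i s hs
    rcases (hμ s).card_le.lt_or_eq with hlt | heq
    · have hno := (hμ s).nonwasteful hlt i hi hi'
      exact Or.inl ⟨(((H s).weak _ hlt).1 _ _ (isCandidate_some hi')
        isCandidate_none).resolve_left hno, hno⟩
    · exact Or.inr heq
  · rw [Finset.sdiff_singleton_eq_erase]
    exact (hμ s).acceptable i hi
  · rintro i j ⟨s, hj, hs, hpri⟩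
    rw [Finset.sdiff_singleton_eq_erase] at hpri
    obtain ⟨hi, hi'⟩ := hblock i s hs
    rw [μ.mem_iff] at hj
    have hce := (H s).card_erase_lt (hμ s).card_le j hj
    have hie : i ∉ (μ.students s).erase j := fun h => hi' (Finset.mem_of_mem_erase h)
    rcases (hμ s).card_le.lt_or_eq with hlt | heq
    -- `IsChoice.fair` covers only full schools. With a free seat, an envious student of the same
    -- type belongs to the initial segment; one of another type is acceptable without `j`, and so
    -- with `j`, whose presence does not affect her type count.
    · by_cases ht : τ s (some i) = τ s (some j)
      · have hn := (H s).num_lt_of_ahead hce hie (by simp) ht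
          ⟨hpri.1, fun h => absurd h hpri.2⟩
        exact hi' ((hμ s).initial i hi j hj ht hn)
      · refine (hμ s).nonwasteful hlt i hi hi' ((H s).acceptable_of_typeCount_le hce hlt hie hi'
          (typeCount_le fun x hx hxt => Finset.mem_erase.2 ⟨?_, hx⟩) ((H s).trans hce
            (isCandidate_some hie) (isCandidate_some (by simp)) isCandidate_none hpri.1
            ((hμ s).acceptable j hj)))
        rintro rfl
        exact ht hxt.symm
    · exact hpri.2 ((hμ s).fair heq i hi hi' j hj).1

/-! ### Existence of compatible numberings -/

theorem exists_equiv_fin_of_total {I : Type*} [Fintype I] (r : I → I → Prop)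
    (htotal : ∀ i j, r i j ∨ r j i) (htrans : ∀ i j k, r i j → r j k → r i k) :
    ∃ e : I ≃ Fin (Fintype.card I), ∀ i j, e i < e j → r i j := by
  classical
  have : Std.Total r := ⟨htotal⟩
  have : IsTrans I r := ⟨htrans⟩
  let l := (Finset.univ : Finset I).toList.insertionSort r
  have hperm := List.perm_insertionSort r (Finset.univ : Finset I).toList
  have hsorted : l.Pairwise r := List.pairwise_insertionSort r _
  have hnodup : l.Nodup := hperm.nodup_iff.2 (Finset.nodup_toList _)
  have hmem : ∀ x, x ∈ l := fun x => hperm.mem_iff.2 (by simp)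
  have hlen : l.length = Fintype.card I := by
    rw [hperm.length_eq, Finset.length_toList, Finset.card_univ]
  let e := hnodup.getEquivOfForallMemList l hmem
  refine ⟨e.symm.trans (finCongr hlen), fun i j hij => ?_⟩
  have hlt : e.symm i < e.symm j := by simpa using hij
  have := List.pairwise_iff_get.1 hsorted _ _ hlt
  have he : ∀ x, l.get (e.symm x) = x := fun x => e.apply_symm_apply x
  rwa [he, he] at this

/-- Students are sorted lexicographically by type number and by priority at `∅`, available as `1 ≤
q`; WO carries the order within a type to every assigned set. -/
theorem exists_compatible {I T : Type*} [Fintype I] [Fintype T] {q : ℕ} (hq : 1 ≤ q)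
    {τ : Option I → T} {pri : PriorityProfile I}
    (hweak : IsWeakOrderProfile q pri) (hWO : WO q τ pri) :
    ∃ ν : Numbering I T, ν.Compatible q τ pri := by
  have hcard : 0 < Fintype.card T := Fintype.card_pos_iff.2 ⟨τ none⟩
  let e₀ := Fintype.equivFin T
  let e : T ≃ Fin (Fintype.card T) := e₀.trans (Equiv.swap (e₀ (τ none)) ⟨0, hcard⟩)
  have he : e (τ none) = ⟨0, hcard⟩ := by simp [e]
  have hcand : ∀ x : Option I, IsCandidate ∅ x := fun x i _ => by simp
  have h0 := hweak ∅ (by rw [Finset.card_empty]; omega)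
  let r : I → I → Prop := fun i j => e (τ (some i)) < e (τ (some j)) ∨
    (e (τ (some i)) = e (τ (some j)) ∧ pri ∅ (some i) (some j))
  obtain ⟨num, hnum⟩ := exists_equiv_fin_of_total r
    (fun i j => by
      have := h0.1 (some i) (some j) (hcand _) (hcand _)
      rcases lt_trichotomy (e (τ (some i))) (e (τ (some j))) with h | h | h
      · exact Or.inl (Or.inl h)
      · exact this.imp (fun h' => Or.inr ⟨h, h'⟩) (fun h' => Or.inr ⟨h.symm, h'⟩)
      · exact Or.inr (Or.inl h))
    (fun i j k => by
      have := h0.2 (some i) (some j) (some k) (hcand _) (hcand _) (hcand _)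
      rintro (h1 | ⟨h1, h1'⟩) (h2 | ⟨h2, h2'⟩)
      · exact Or.inl (h1.trans h2)
      · exact Or.inl (h2 ▸ h1)
      · exact Or.inl (h1 ▸ h2)
      · exact Or.inr ⟨h1.trans h2, this h1' h2'⟩)
  refine ⟨⟨e, num⟩, by simp [he], fun i j h => ?_, fun i j ht hn J hJ hi hj => ?_⟩
  · by_contra hn
    have hij : i ≠ j := by rintro rfl; exact lt_irrefl _ h
    rcases hnum j i (lt_of_le_of_ne (not_lt.1 hn) fun e => hij (num.injective e.symm)) with h' | h'
    · exact lt_asymm h h'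
    · exact h.ne h'.1.symm
  · have h' : pri ∅ (some i) (some j) := by
      rcases hnum i j hn with h' | h'
      · exact absurd (ht ▸ h') (lt_irrefl _)
      · exact h'.2
    exact (hWO ∅ J (some i) (some j) (by rw [Finset.card_empty]; omega) hJ (hcand _) (hcand _)
      (isCandidate_some hi) (isCandidate_some hj) ht).2 h'

end SchoolChoice
theorem theorem1 {S I T : Type*} [Fintype S] [DecidableEq S] [Fintype I] [DecidableEq I]
    [Fintype T] (q : S → ℕ) (hq : ∀ s, 1 ≤ q s)
    (τ : S → Option I → T) (hτ : ∀ s i, τ s none ≠ τ s (some i))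
    (pri : S → SchoolChoice.PriorityProfile I)
    (hweak : ∀ s, SchoolChoice.IsWeakOrderProfile (q s) (pri s))
    (hPD : ∀ s, SchoolChoice.PD (q s) (τ s) (pri s))
    (hWO : ∀ s, SchoolChoice.WO (q s) (τ s) (pri s))
    (hDC : ∀ s, SchoolChoice.DC (q s) (τ s) (pri s)) :
    -- compatible numberings exist
    (∀ s, ∃ ν : SchoolChoice.Numbering I T, ν.Compatible (q s) (τ s) (pri s)) ∧
    -- and for every choice of them the mechanism is well defined, stable and group strategy-proof
    ∀ ν : S → SchoolChoice.Numbering I T,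
      (∀ s, (ν s).Compatible (q s) (τ s) (pri s)) →
      ∀ C : S → Finset I → Finset I,
        (∀ s J, C s J = SchoolChoice.choiceFn (q s) (pri s) (ν s).num J) →
        (∀ P : I → SchoolChoice.Pref S, SchoolChoice.SPDATerminates C P ∧
          ∃! μ : SchoolChoice.Matching S I q, SchoolChoice.IsSPDAOutcome C P μ) ∧
        ∀ φ : SchoolChoice.Mechanism S I q,
          (∀ P, SchoolChoice.IsSPDAOutcome C P (φ P)) →
          SchoolChoice.StableMechanism pri φ ∧ SchoolChoice.GroupStrategyProof φ := by
  refine ⟨fun s => SchoolChoice.exists_compatible (hq s) (hweak s) (hWO s), fun ν hν C hCν => ?_⟩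
  have H : ∀ s, SchoolChoice.NumberedSchool (q s) (τ s) (pri s) (ν s) := fun s =>
    ⟨hq s, hτ s, hweak s, hPD s, hWO s, hDC s, hν s⟩
  have hchoice : ∀ s J, SchoolChoice.IsChoice (q s) (τ s) (pri s) (ν s) J (C s J) := fun s J =>
    hCν s J ▸ (H s).isChoice_choiceFn J
  have hC : ∀ s, SchoolChoice.IsSubstitutable (C s) := fun s => by
    rw [funext (hCν s)]
    exact (H s).isSubstitutable
  exact ⟨fun P => ⟨SchoolChoice.spdaTerminates hC P,
      SchoolChoice.existsUnique_outcome hC (fun s J => (hchoice s J).card_le) P⟩,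
    fun φ hφ => ⟨fun P => (hφ P).stable H hC hchoice,
      SchoolChoice.groupStrategyProof_of_isSPDAOutcome hC φ hφ⟩⟩
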